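/- Let $m\ge 4$ be an integer and let $1<p_1,\dots,p_m<\infty$ and $p$ be real numbers with $\sum_{i=1}^m \frac1{p_i}=\frac1p$ (so $p>0$, and $p<1$ is allowed). For $\alpha>0$, $R>0$ and Schwartz functions $f_1,\dots,f_m:\mathbb R\to\mathbb C$ put \[ \mathfrak B^{\alpha}_R(f_1,\dots,f_m)(x)=\int_{\mathbb R^m}\Big(1-\frac{|\xi|^2}{R^2}\Big)_+^{\alpha}\ \prod_{i=1}^m\widehat{f_i}(\xi_i)\ e^{2\pi \mathrm i x(\xi_1+\dots+\xi_m)}\,d\xi,\qquad |\xi|^2=\sum_{i=1}^m\xi_i^2, \] where $r_+=\max\{r,0\}$ and $\widehat f(\xi)=\int_{\mathbb R} f(y)e^{-2\pi \mathrm i y\xi}\,dy$, and let \[ \mathfrak B^{\alpha}_*(f_1,\dots,f_m)(x)=\sup_{R>0}\big|\mathfrak B^{\alpha}_R(f_1,\dots,f_m)(x)\big| \] be the $m$-linear maximal Bochner--Riesz operator in dimension one. Then there is a finite constant $C=C(m,p_1,\dots,p_m,\alpha)$ such that \[ \big\|\mathfrak B^{\alpha}_*(f_1,\dots,f_m)\big\|_{L^p(\mathbb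 R)}\le C\prod_{i=1}^m\|f_i\|_{L^{p_i}(\mathbb R)} \] for all Schwartz functions $f_1,\dots,f_m$ on $\mathbb R$, in each of the following cases: \begin{enumerate} \item $p_i\ge 2$ for all $i$, and $\alpha>\frac{m-2}{2}$; \item for some $1\le l\le m-1$ there is a set $S\subset\{1,\dots,m\}$ with exactly $l$ elements such that $1<p_i<2$ for $i\in S$ and $2\le p_i<\infty$ for $i\notin S$, and $\alpha>\sum_{i\in S}\frac1{p_i}+\frac{m-l-2}{2}$; \item $1<p_i<2$ for all $i$, and $\alpha>\frac1p-1$. \end{enumerate} -/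

import Mathlib

open MeasureTheory
open scoped ENNReal NNReal FourierTransform SchwartzMap

/-- The `m`-linear Bochner–Riesz multiplier `(1 - |ξ|² / R²)₊ ^ α` on `ℝᵐ` (here
`|ξ|² = ∑ᵢ ξᵢ²` is the Euclidean norm). It is used for `α > 0`. -/
noncomputable def bochnerRieszMultiplier {m : ℕ} (α R : ℝ) (ξ : Fin m → ℝ) : ℝ :=
  (max (1 - (∑ i, ξ i ^ 2) / R ^ 2) 0) ^ α

/-- The `m`-linear Bochner–Riesz mean of order `α` at scale `R` in dimension `n = 1`,
`∫_{ℝᵐ} (1 - |ξ|² / R²)₊ ^ α ∏ᵢ f̂ᵢ(ξᵢ) e^{2πi x (ξ₁ + ⋯ + ξₘ)} dξ`, where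
`f̂(ξ) = ∫ f(y) e^{-2πi y ξ} dy`. -/
noncomputable def bochnerRieszMean {m : ℕ} (α R : ℝ) (f : Fin m → 𝓢(ℝ, ℂ)) (x : ℝ) : ℂ :=
  ∫ ξ : Fin m → ℝ,
    (bochnerRieszMultiplier α R ξ : ℂ) * (∏ i, 𝓕 (f i : ℝ → ℂ) (ξ i)) *
      Complex.exp (2 * Real.pi * Complex.I * (x * ∑ i, ξ i : ℝ))

/-- The `m`-linear maximal Bochner–Riesz operator `sup_{R > 0} |𝔅_R^α(f₁, …, fₘ)(x)|`, with
values in `[0, ∞]`. -/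
noncomputable def maximalBochnerRiesz {m : ℕ} (α : ℝ) (f : Fin m → 𝓢(ℝ, ℂ)) (x : ℝ) : ℝ≥0∞ :=
  ⨆ (R : ℝ) (_ : 0 < R), ‖bochnerRieszMean α R f x‖ₑ

/-- The maximal operator is bounded from `L^{q₁} × ⋯ × L^{qₘ}` to `L^p`: there is a constant `C`
with `‖𝔅_*^α(f₁, …, fₘ)‖_{L^p} ≤ C ∏ᵢ ‖fᵢ‖_{L^{qᵢ}}` for all Schwartz functions `f₁, …, fₘ`. -/
def MaximalBochnerRieszBounded {m : ℕ} (α : ℝ) (q : Fin m → ℝ) (p : ℝ) : Prop :=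
  ∃ C : ℝ≥0, ∀ f : Fin m → 𝓢(ℝ, ℂ),
    eLpNorm (maximalBochnerRiesz α f) (ENNReal.ofReal p) volume ≤
      C * ∏ i, eLpNorm (f i) (ENNReal.ofReal (q i)) volume

/-! The multiplier is made to separate. By Laplace inversion (`ofReal_max_rpow_eq_integral`), the
truncated power `v₊ ^ α` is a constant times the integral over τ of `(1 + iτ)^(-(α+1)) e^{(1+iτ)v}`.
At `v = 1 - |ξ|²/R²` the exponential is a product over the coordinates, so
`bochnerRieszMean_eq_integral` expresses the mean as an integral over τ of a weight of size `(1 +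
τ²)^(-(α+1)/2)` times a product of m one-variable damped Schrödinger evolutions `dampedEvolution`.

In physical space each evolution is a complex Gaussian average of f around x, and rescaling removes
R. Two bounds hold, both uniform in R. Pointwise, it is at most `(1 + τ²)^(1/4)` times the maximal
function of f (`exists_enorm_dampedEvolution_le`). In mean square over τ there is a gain: with
weight `(1 + τ²)^(-a)`, the integral of its square is at most a constant times `M(|f|^s)(x)^(2/s)`
whenever `1 < s < 2` and `a s > 1` (`exists_lintegral_dampedEvolution_sq_le`). The latter is a `T
T*` argument: one integration by parts in τ bounds the kernel by `(1 + y² + y'²)^(-a) (1 + ||y| -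
|y'||)⁻¹`, and a Young-type inequality, available because `s < 2`, handles the resulting bilinear
form.

Using Cauchy–Schwarz in τ on two of the factors and the pointwise bound on the other `m - 2`
dominates the maximal operator by a product of maximal functions (`exists_maximalBochnerRiesz_le`).
The powers of `1 + τ²` balance when `a₀ + a₁ = α + 2 - m/2`. Hölder's inequality and the maximal
theorem then give the norm bound, also for `p < 1`. Suitable `a₀`, `a₁` exist as soon as `α > ∑
max(1/qᵢ, 1/2) - 1`, and this single condition becomes the stated threshold in each of the three
cases. -/

/-! ### The Hardy–Littlewood maximal theorem on the line -/

/-- The centred Hardy–Littlewood maximal function over intervals of dyadic radius. -/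
noncomputable def dyadicMaximal (F : ℝ → ℝ≥0∞) (x : ℝ) : ℝ≥0∞ :=
  ⨆ k : ℤ, (volume (Metric.closedBall x ((2 : ℝ) ^ k)))⁻¹ *
    ∫⁻ y in Metric.closedBall x ((2 : ℝ) ^ k), F y

lemma volume_closedBall_zpow (x : ℝ) (k : ℤ) :
    volume (Metric.closedBall x ((2 : ℝ) ^ k)) = ENNReal.ofReal (2 * 2 ^ k) :=
  Real.volume_closedBall x _

lemma measurable_dyadicMaximal {F : ℝ → ℝ≥0∞} (hF : Measurable F) :
    Measurable (dyadicMaximal F) := by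
  refine Measurable.iSup fun k => ?_
  simp only [volume_closedBall_zpow]
  refine Measurable.const_mul ?_ _
  have h : ∀ x, ∫⁻ y in Metric.closedBall x ((2 : ℝ) ^ k), F y =
      ∫⁻ y, {p : ℝ × ℝ | dist p.2 p.1 ≤ (2 : ℝ) ^ k}.indicator (fun p => F p.2) (x, y) := by
    intro x
    rw [← lintegral_indicator Metric.isClosed_closedBall.measurableSet]
    rfl
  simp only [h]
  refine Measurable.lintegral_prod_right' ?_
  refine (hF.comp measurable_snd).indicator ?_
  exact (isClosed_le (by fun_prop) continuous_const).measurableSet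

lemma setLIntegral_closedBall_le_dyadicMaximal (F : ℝ → ℝ≥0∞) (x : ℝ) (k : ℤ) :
    ∫⁻ y in Metric.closedBall x ((2 : ℝ) ^ k), F y ≤
      ENNReal.ofReal (2 * 2 ^ k) * dyadicMaximal F x := by
  have h := le_iSup (fun k : ℤ => (volume (Metric.closedBall x ((2 : ℝ) ^ k)))⁻¹ *
    ∫⁻ y in Metric.closedBall x ((2 : ℝ) ^ k), F y) k
  rw [volume_closedBall_zpow] at h
  have h0 : ENNReal.ofReal (2 * 2 ^ k) ≠ 0 := by
    rw [Ne, ENNReal.ofReal_eq_zero, not_le]; positivity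
  calc _ = ENNReal.ofReal (2 * 2 ^ k) * ((ENNReal.ofReal (2 * 2 ^ k))⁻¹ *
        ∫⁻ y in Metric.closedBall x ((2 : ℝ) ^ k), F y) := by
        rw [← mul_assoc, ENNReal.mul_inv_cancel h0 ENNReal.ofReal_ne_top, one_mul]
    _ ≤ _ := mul_le_mul_right h _

lemma dyadicMaximal_le_of_le {F : ℝ → ℝ≥0∞} {B : ℝ≥0∞} (hB : ∀ x, F x ≤ B) (x : ℝ) :
    dyadicMaximal F x ≤ B := by
  refine iSup_le fun k => ?_
  have h0 : volume (Metric.closedBall x ((2 : ℝ) ^ k)) ≠ 0 := by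
    rw [volume_closedBall_zpow, Ne, ENNReal.ofReal_eq_zero, not_le]; positivity
  have ht : volume (Metric.closedBall x ((2 : ℝ) ^ k)) ≠ ∞ := by
    rw [volume_closedBall_zpow]; exact ENNReal.ofReal_ne_top
  calc _ ≤ (volume (Metric.closedBall x ((2 : ℝ) ^ k)))⁻¹ *
        ∫⁻ y in Metric.closedBall x ((2 : ℝ) ^ k), B :=
        mul_le_mul_right (lintegral_mono hB) _
    _ = B := by
        rw [setLIntegral_const, mul_comm B, ← mul_assoc, ENNReal.inv_mul_cancel h0 ht, one_mul]

lemma dyadicMaximal_add_le {F G : ℝ → ℝ≥0∞} (hF : Measurable F) (x : ℝ) :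
    dyadicMaximal (fun y => F y + G y) x ≤ dyadicMaximal F x + dyadicMaximal G x := by
  refine iSup_le fun k => ?_
  rw [lintegral_add_left hF, mul_add]
  exact add_le_add
    (le_iSup (fun k : ℤ => (volume (Metric.closedBall x ((2 : ℝ) ^ k)))⁻¹ *
      ∫⁻ y in Metric.closedBall x ((2 : ℝ) ^ k), F y) k)
    (le_iSup (fun k : ℤ => (volume (Metric.closedBall x ((2 : ℝ) ^ k)))⁻¹ *
      ∫⁻ y in Metric.closedBall x ((2 : ℝ) ^ k), G y) k)

lemma dyadicMaximal_mono {F G : ℝ → ℝ≥0∞} (h : ∀ y, F y ≤ G y) (x : ℝ) :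
    dyadicMaximal F x ≤ dyadicMaximal G x :=
  iSup_mono fun _ => mul_le_mul_right (lintegral_mono h) _

/-- The weak type `(1, 1)` inequality. -/
lemma mul_volume_lt_dyadicMaximal_le (F : ℝ → ℝ≥0∞) (c : ℝ≥0∞) :
    c * volume {x | c < dyadicMaximal F x} ≤ 4 * ∫⁻ y, F y := by
  rcases eq_or_ne c 0 with rfl | hc0
  · simp
  rcases eq_or_ne c ∞ with rfl | hct
  · simp
  rcases eq_or_ne (∫⁻ y, F y) ∞ with hI | hI
  · rw [hI]; simp
  -- The balls on which the average exceeds c. Their radii are bounded because F has finite integral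
  -- and c is positive, as the Vitali covering argument requires.
  let t : Set (ℝ × ℤ) := {p | c * ENNReal.ofReal (2 * 2 ^ p.2) <
    ∫⁻ y in Metric.closedBall p.1 ((2 : ℝ) ^ p.2), F y}
  have hR : ∀ a ∈ t, (2 : ℝ) ^ a.2 ≤ ((∫⁻ y, F y) / c).toReal := by
    intro a ha
    have h1 : c * ENNReal.ofReal (2 * 2 ^ a.2) ≤ ∫⁻ y, F y :=
      ha.le.trans (setLIntegral_le_lintegral _ _)
    have h2 : ENNReal.ofReal (2 * 2 ^ a.2) ≤ (∫⁻ y, F y) / c := by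
      rw [ENNReal.le_div_iff_mul_le (Or.inl hc0) (Or.inl hct), mul_comm]; exact h1
    have h3 := (ENNReal.ofReal_le_iff_le_toReal (ENNReal.div_ne_top hI hc0)).1 h2
    have : (0 : ℝ) < 2 ^ a.2 := by positivity
    linarith
  -- The enlargement factor 4 is what becomes the constant of the weak-type bound.
  obtain ⟨u, hut, hdis, hcov⟩ := Vitali.exists_disjoint_subfamily_covering_enlargement_closedBall
    t (fun a => a.1) (fun a => (2 : ℝ) ^ a.2) _ hR 4 (by norm_num)
  have hcount : u.Countable := by
    refine hdis.countable_of_nonempty_interior fun a _ => ?_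
    exact ⟨a.1, Metric.ball_subset_interior_closedBall
      (Metric.mem_ball_self (by positivity))⟩
  have hsub : {x | c < dyadicMaximal F x} ⊆
      ⋃ b ∈ u, Metric.closedBall b.1 (4 * (2 : ℝ) ^ b.2) := by
    intro x hx
    obtain ⟨k, hk⟩ := lt_iSup_iff.1 (show c < dyadicMaximal F x from hx)
    rw [volume_closedBall_zpow] at hk
    have h0 : ENNReal.ofReal (2 * 2 ^ k) ≠ 0 := by
      rw [Ne, ENNReal.ofReal_eq_zero, not_le]; positivity
    have hmem : ((x, k) : ℝ × ℤ) ∈ t := by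
      have := ENNReal.mul_lt_mul_left h0 ENNReal.ofReal_ne_top hk
      rwa [mul_right_comm, ENNReal.inv_mul_cancel h0 ENNReal.ofReal_ne_top, one_mul] at this
    obtain ⟨b, hb, hsub⟩ := hcov _ hmem
    exact Set.mem_biUnion hb (hsub (Metric.mem_closedBall_self (by positivity)))
  have hm : MeasurableSet (⋃ b ∈ u, Metric.closedBall b.1 ((2 : ℝ) ^ b.2)) :=
    MeasurableSet.biUnion hcount fun b _ => Metric.isClosed_closedBall.measurableSet
  calc c * volume {x | c < dyadicMaximal F x}
      ≤ c * ∑' b : u, volume (Metric.closedBall b.1.1 (4 * (2 : ℝ) ^ b.1.2)) :=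
        mul_le_mul_right ((measure_mono hsub).trans (measure_biUnion_le _ hcount _)) _
    _ = ∑' b : u, 4 * (c * ENNReal.ofReal (2 * 2 ^ b.1.2)) := by
        rw [← ENNReal.tsum_mul_left]
        congr 1; ext b
        rw [Real.volume_closedBall, show (2 : ℝ) * (4 * 2 ^ b.1.2) = 4 * (2 * 2 ^ b.1.2) by ring,
          ENNReal.ofReal_mul (by norm_num)]
        simp only [ENNReal.ofReal_ofNat]
        ring
    _ ≤ ∑' b : u, 4 * ∫⁻ y in Metric.closedBall b.1.1 ((2 : ℝ) ^ b.1.2), F y :=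
        ENNReal.tsum_le_tsum fun b => mul_le_mul_right (hut b.2).le _
    _ = 4 * ∫⁻ y in ⋃ b ∈ u, Metric.closedBall b.1 ((2 : ℝ) ^ b.2), F y := by
        rw [ENNReal.tsum_mul_left, lintegral_biUnion hcount
          (fun b _ => Metric.isClosed_closedBall.measurableSet) hdis]
    _ ≤ 4 * ∫⁻ y, F y := mul_le_mul_right (setLIntegral_le_lintegral _ _) _

/-- Truncation at height t/2: the part of F below it contributes at most t/2 to the maximal
function, so only the part above it, supported where `2 F > t`, needs the weak-type bound at level
t/2. This is the input for Marcinkiewicz interpolation. -/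
lemma ofReal_mul_volume_lt_dyadicMaximal_le {F : ℝ → ℝ≥0∞} (hF : Measurable F) (t : ℝ) :
    ENNReal.ofReal t * volume {x | ENNReal.ofReal t < dyadicMaximal F x} ≤
      8 * volume.withDensity F {x | ENNReal.ofReal t < 2 * F x} := by
  set A : Set ℝ := {x | ENNReal.ofReal t < 2 * F x} with hA
  have hAm : MeasurableSet A := measurableSet_lt measurable_const (hF.const_mul 2)
  set c := ENNReal.ofReal (t / 2) with hc
  have h2c : ENNReal.ofReal t = 2 * c := by
    rw [hc, ← ENNReal.ofReal_ofNat 2, ← ENNReal.ofReal_mul (by norm_num)]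
    congr 1; ring
  have hsub : {x | ENNReal.ofReal t < dyadicMaximal F x} ⊆
      {x | c < dyadicMaximal (A.indicator F) x} := by
    intro x hx
    have h1 : dyadicMaximal F x ≤ dyadicMaximal (A.indicator F) x + c := by
      refine (dyadicMaximal_mono (G := fun y => A.indicator F y + Aᶜ.indicator F y)
        (fun y => (congrFun (Set.indicator_self_add_compl A F) y).ge) x).trans ?_
      refine (dyadicMaximal_add_le (hF.indicator hAm) x).trans
        (add_le_add_right (dyadicMaximal_le_of_le (fun y => ?_) x) _)
      by_cases hy : y ∈ A
      · simp [hy]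
      · rw [Set.indicator_of_mem (by exact hy)]
        have : 2 * F y ≤ 2 * c := by rw [← h2c]; exact not_lt.1 hy
        exact (ENNReal.mul_le_mul_iff_right (by norm_num) (by norm_num)).1 this
    have h2 : c + c < dyadicMaximal (A.indicator F) x + c := by
      rw [← two_mul, ← h2c]; exact lt_of_lt_of_le hx h1
    exact lt_of_add_lt_add_right h2
  calc _ ≤ 2 * (c * volume {x | c < dyadicMaximal (A.indicator F) x}) := by
        rw [h2c, mul_assoc]
        exact mul_le_mul_right (mul_le_mul_right (measure_mono (h2c ▸ hsub)) _) _
    _ ≤ 2 * (4 * ∫⁻ y, A.indicator F y) :=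
        mul_le_mul_right (mul_volume_lt_dyadicMaximal_le _ _) _
    _ = _ := by
        rw [withDensity_apply _ hAm, lintegral_indicator hAm, ← mul_assoc]; norm_num

/-- The strong type inequality for the maximal function, for bounded functions. -/
lemma lintegral_dyadicMaximal_rpow_le {r : ℝ} (hr : 1 < r) : ∃ C : ℝ≥0, ∀ F : ℝ → ℝ≥0∞,
    Measurable F → ∀ B : ℝ≥0∞, B ≠ ∞ → (∀ x, F x ≤ B) →
      ∫⁻ x, dyadicMaximal F x ^ r ≤ C * ∫⁻ x, F x ^ r := by
  refine ⟨(r * 8 * (r - 1)⁻¹ * 2 ^ (r - 1)).toNNReal, fun F hF B hBt hB => ?_⟩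
  have hMt : ∀ x, dyadicMaximal F x ≠ ∞ := fun x =>
    ((dyadicMaximal_le_of_le hB x).trans_lt hBt.lt_top).ne
  have hFt : ∀ x, 2 * F x ≠ ∞ := fun x =>
    ENNReal.mul_ne_top (by norm_num) ((hB x).trans_lt hBt.lt_top).ne
  -- Layer cake is used twice: for the maximal function under Lebesgue measure with exponent r, and
  -- for 2F under the measure F dx with exponent r - 1. The truncated weak-type inequality compares
  -- the two integrands for each t.
  have h1 := lintegral_rpow_eq_lintegral_meas_lt_mul volume
    (f := fun x => (dyadicMaximal F x).toReal) (ae_of_all _ fun x => ENNReal.toReal_nonneg)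
    (measurable_dyadicMaximal hF).ennreal_toReal.aemeasurable (p := r) (by linarith)
  have h2 := lintegral_rpow_eq_lintegral_meas_lt_mul (volume.withDensity F)
    (f := fun x => (2 * F x).toReal) (ae_of_all _ fun x => ENNReal.toReal_nonneg)
    (hF.const_mul 2).ennreal_toReal.aemeasurable (p := r - 1) (by linarith)
  have e1 : ∀ x, ENNReal.ofReal ((dyadicMaximal F x).toReal ^ r) = dyadicMaximal F x ^ r := by
    intro x
    rw [← ENNReal.ofReal_rpow_of_nonneg ENNReal.toReal_nonneg (by linarith),
      ENNReal.ofReal_toReal (hMt x)]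
  have e2 : ∀ x, ENNReal.ofReal ((2 * F x).toReal ^ (r - 1)) = (2 * F x) ^ (r - 1) := by
    intro x
    rw [← ENNReal.ofReal_rpow_of_nonneg ENNReal.toReal_nonneg (by linarith),
      ENNReal.ofReal_toReal (hFt x)]
  simp only [e1] at h1
  simp only [e2] at h2
  rw [lintegral_withDensity_eq_lintegral_mul _ hF (by fun_prop)] at h2
  have e3 : ∀ x, (F * fun x => (2 * F x) ^ (r - 1)) x = 2 ^ (r - 1) * F x ^ r := by
    intro x
    simp only [Pi.mul_apply]
    rw [ENNReal.mul_rpow_of_nonneg _ _ (by linarith), mul_left_comm]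
    congr 1
    nth_rewrite 1 [← ENNReal.rpow_one (F x)]
    rw [← ENNReal.rpow_add_of_nonneg _ _ zero_le_one (by linarith)]
    congr 1; ring
  simp only [e3] at h2
  rw [lintegral_const_mul _ (by fun_prop)] at h2
  set J := ∫⁻ (t : ℝ) in Set.Ioi 0, volume.withDensity F {a | t < (2 * F a).toReal} *
    ENNReal.ofReal (t ^ (r - 1 - 1)) with hJ
  have hr1 : ENNReal.ofReal (r - 1) ≠ 0 := by
    rw [Ne, ENNReal.ofReal_eq_zero, not_le]; linarith
  have hJe : J = (ENNReal.ofReal (r - 1))⁻¹ * (2 ^ (r - 1) * ∫⁻ x, F x ^ r) := by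
    rw [h2, ← mul_assoc, ENNReal.inv_mul_cancel hr1 ENNReal.ofReal_ne_top, one_mul]
  have h3 : ∫⁻ (t : ℝ) in Set.Ioi 0, volume {a | t < (dyadicMaximal F a).toReal} *
      ENNReal.ofReal (t ^ (r - 1)) ≤ 8 * J := by
    have hJm : AEMeasurable (fun t : ℝ => volume.withDensity F {a | t < (2 * F a).toReal} *
        ENNReal.ofReal (t ^ (r - 1 - 1))) (volume.restrict (Set.Ioi 0)) := by
      refine AEMeasurable.mul ?_ (by fun_prop)
      exact (Antitone.measurable fun a b hab =>
        measure_mono fun x (hx : b < (2 * F x).toReal) => lt_of_le_of_lt hab hx).aemeasurable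
    rw [hJ, ← lintegral_const_mul'' _ hJm]
    refine setLIntegral_mono_ae' measurableSet_Ioi (ae_of_all _ fun t ht => ?_)
    have ht' : 0 < t := ht
    have h := ofReal_mul_volume_lt_dyadicMaximal_le hF t
    have s1 : {a | t < (dyadicMaximal F a).toReal} =
        {x | ENNReal.ofReal t < dyadicMaximal F x} := by
      ext x; exact (ENNReal.ofReal_lt_iff_lt_toReal ht'.le (hMt x)).symm
    have s2 : {a | t < (2 * F a).toReal} = {x | ENNReal.ofReal t < 2 * F x} := by
      ext x; exact (ENNReal.ofReal_lt_iff_lt_toReal ht'.le (hFt x)).symm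
    have e4 : ENNReal.ofReal (t ^ (r - 1)) =
        ENNReal.ofReal t * ENNReal.ofReal (t ^ (r - 1 - 1)) := by
      rw [← ENNReal.ofReal_mul ht'.le]
      congr 1
      nth_rewrite 2 [← Real.rpow_one t]
      rw [← Real.rpow_add ht']; congr 1; ring
    rw [s1, s2, e4, ← mul_assoc, ← mul_assoc, mul_comm _ (ENNReal.ofReal t)]
    exact mul_le_mul_left h _
  rw [h1]
  calc _ ≤ ENNReal.ofReal r * (8 * J) := mul_le_mul_right h3 _
    _ = _ := by
      rw [hJe]
      have h8 : (8 : ℝ≥0∞) = ENNReal.ofReal 8 := by simp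
      have h2 : (2 : ℝ≥0∞) ^ (r - 1) = ENNReal.ofReal (2 ^ (r - 1)) := by
        rw [← ENNReal.ofReal_rpow_of_pos (by norm_num)]; simp
      rw [← ENNReal.ofReal_inv_of_pos (by linarith), h8, h2, ← ENNReal.ofReal.eq_1,
        ENNReal.ofReal_mul (by have := inv_pos.2 (sub_pos.2 hr); positivity),
        ENNReal.ofReal_mul (by linarith), ENNReal.ofReal_mul (by linarith)]
      ring

lemma lintegral_comp_sub_div {G : ℝ → ℝ≥0∞} (hG : Measurable G) (x : ℝ)
    {ρ : ℝ} (hρ : 0 < ρ) :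
    ∫⁻ v, G (x - v / ρ) = ENNReal.ofReal ρ * ∫⁻ y, G y := by
  have hm : Measurable fun y => G (x - y) := hG.comp (measurable_const.sub measurable_id)
  have h := Real.smul_map_volume_mul_left (inv_pos.2 hρ).ne'
  have h2 : ∫⁻ y, G (x - y) = ENNReal.ofReal ρ⁻¹ * ∫⁻ v, G (x - ρ⁻¹ * v) := by
    conv_lhs => rw [← h]
    rw [lintegral_smul_measure, lintegral_map hm (measurable_const_mul _),
      abs_of_pos (inv_pos.2 hρ), smul_eq_mul]
  rw [lintegral_sub_left_eq_self] at h2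
  rw [h2, ← mul_assoc, ← ENNReal.ofReal_mul hρ.le, mul_inv_cancel₀ hρ.ne', ENNReal.ofReal_one,
    one_mul]
  simp only [div_eq_inv_mul]

lemma setLIntegral_abs_le_comp_le_dyadicMaximal {F : ℝ → ℝ≥0∞} (hF : Measurable F) (x : ℝ)
    {ρ : ℝ} (hρ : 0 < ρ) {r : ℝ} (hr : 0 < r) :
    ∫⁻ v in {v : ℝ | |v| ≤ r}, F (x - v / ρ) ≤ ENNReal.ofReal (4 * r) * dyadicMaximal F x := by
  -- Rounding the radius r/ρ up to a power of two at most doubles it, which turns the interval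
  -- length 2r into 4r.
  obtain ⟨j, hj1, hj2⟩ := exists_mem_Ioc_zpow (div_pos hr hρ) (one_lt_two)
  have hm : MeasurableSet {v : ℝ | |v| ≤ r} := measurableSet_le (by fun_prop) measurable_const
  have h2 : (2 : ℝ) ^ (j + 1) = 2 * 2 ^ j := by rw [zpow_add_one₀ (by norm_num)]; ring
  calc ∫⁻ v in {v : ℝ | |v| ≤ r}, F (x - v / ρ)
      ≤ ∫⁻ v, (Metric.closedBall x ((2 : ℝ) ^ (j + 1))).indicator F (x - v / ρ) := by
        rw [← lintegral_indicator hm]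
        refine lintegral_mono fun v => ?_
        by_cases hv : |v| ≤ r
        · rw [Set.indicator_of_mem (by exact hv), Set.indicator_of_mem]
          rw [Metric.mem_closedBall, Real.dist_eq, sub_sub_cancel_left, abs_neg, abs_div,
            abs_of_pos hρ]
          exact (div_le_div_of_nonneg_right hv hρ.le).trans hj2
        · rw [Set.indicator_of_notMem (by exact hv)]; exact zero_le
    _ = ENNReal.ofReal ρ * ∫⁻ y in Metric.closedBall x ((2 : ℝ) ^ (j + 1)), F y := by
        rw [lintegral_comp_sub_div
          (hF.indicator Metric.isClosed_closedBall.measurableSet) x hρ,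
          lintegral_indicator Metric.isClosed_closedBall.measurableSet]
    _ ≤ ENNReal.ofReal ρ * (ENNReal.ofReal (2 * 2 ^ (j + 1)) * dyadicMaximal F x) :=
        mul_le_mul_right (setLIntegral_closedBall_le_dyadicMaximal F x _) _
    _ ≤ _ := by
        rw [← mul_assoc, ← ENNReal.ofReal_mul hρ.le]
        refine mul_le_mul_left (ENNReal.ofReal_le_ofReal ?_) _
        rw [lt_div_iff₀ hρ] at hj1
        rw [h2]; linarith

/-- Averages against polynomially decaying weights are controlled by the maximal function. -/
lemma lintegral_one_add_abs_rpow_mul_le_dyadicMaximal {b : ℝ} (hb : 1 < b) :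
    ∃ C : ℝ≥0, ∀ F : ℝ → ℝ≥0∞, Measurable F → ∀ x ρ : ℝ, 0 < ρ → ∀ l : ℝ, 0 < l →
      ∫⁻ v, ENNReal.ofReal ((1 + |v| / l) ^ (-b)) * F (x - v / ρ) ≤
        C * ENNReal.ofReal l * dyadicMaximal F x := by
  -- The weight is dominated by a sum of indicators of dyadic balls with coefficients `w k`. The
  -- mass of the k-th ball is then geometric with ratio `2^(1-b)`, which is less than 1 since `b >
  -- 1`.
  set w : ℕ → ℝ := fun k => ((2 : ℝ) ^ k / 2) ^ (-b) with hw
  have hw0 : ∀ k, 0 ≤ w k := fun k => by positivity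
  have hwe : ∀ k, w k * (4 * 2 ^ k) = (4 * 2 ^ b) * (2 ^ (1 - b)) ^ k := by
    intro k
    have h2 : (0 : ℝ) < 2 ^ k := by positivity
    rw [hw]
    simp only
    rw [Real.div_rpow h2.le (by norm_num), Real.rpow_neg (by norm_num : (0 : ℝ) ≤ 2), div_inv_eq_mul,
      ← Real.rpow_natCast, ← Real.rpow_natCast, ← Real.rpow_mul (by norm_num),
      ← Real.rpow_mul (by norm_num), show (1 - b) * (k : ℝ) = k * -b + k by ring,
      Real.rpow_add (by norm_num)]
    ring
  have hsum : Summable fun k => w k * (4 * 2 ^ k) := by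
    simp only [hwe]
    refine Summable.mul_left _ (summable_geometric_of_lt_one (by positivity) ?_)
    exact Real.rpow_lt_one_of_one_lt_of_neg (by norm_num) (by linarith)
  refine ⟨(∑' k, w k * (4 * 2 ^ k)).toNNReal, fun F hF x ρ hρ l hl => ?_⟩
  have hms : ∀ k : ℕ, MeasurableSet {v : ℝ | |v| ≤ l * (2 : ℝ) ^ k} := fun k =>
    measurableSet_le (by fun_prop) measurable_const
  have hFm : Measurable fun v => F (x - v / ρ) := hF.comp (by fun_prop)
  calc ∫⁻ v, ENNReal.ofReal ((1 + |v| / l) ^ (-b)) * F (x - v / ρ)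
      ≤ ∫⁻ v, ∑' k, ENNReal.ofReal (w k) *
          {v : ℝ | |v| ≤ l * (2 : ℝ) ^ k}.indicator (fun v => F (x - v / ρ)) v := by
        refine lintegral_mono fun v => ?_
        obtain ⟨n, hn1, hn2⟩ := exists_nat_pow_near (show 1 ≤ 1 + |v| / l by linarith [div_nonneg (abs_nonneg v) hl.le])
          (one_lt_two : (1 : ℝ) < 2)
        refine le_trans ?_ (ENNReal.le_tsum (n + 1))
        rw [Set.indicator_of_mem (by show |v| ≤ _; rw [mul_comm, ← div_le_iff₀ hl]; linarith)]
        refine mul_le_mul_left (ENNReal.ofReal_le_ofReal ?_) _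
        refine Real.rpow_le_rpow_of_nonpos (by positivity) ?_ (by linarith)
        rw [pow_succ]; linarith
    _ = ∑' k, ENNReal.ofReal (w k) * ∫⁻ v in {v : ℝ | |v| ≤ l * (2 : ℝ) ^ k}, F (x - v / ρ) := by
        rw [lintegral_tsum fun k => ((hFm.indicator (hms k)).const_mul _).aemeasurable]
        congr 1; ext k
        rw [lintegral_const_mul _ (hFm.indicator (hms k)), lintegral_indicator (hms k)]
    _ ≤ ∑' k, ENNReal.ofReal (w k * (4 * 2 ^ k)) * ENNReal.ofReal l * dyadicMaximal F x := by
        refine ENNReal.tsum_le_tsum fun k => ?_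
        rw [← ENNReal.ofReal_mul (mul_nonneg (hw0 k) (by positivity)), mul_assoc (w k),
          ENNReal.ofReal_mul (hw0 k), mul_assoc, show 4 * 2 ^ k * l = 4 * (l * 2 ^ k) by ring]
        exact mul_le_mul_right
          (setLIntegral_abs_le_comp_le_dyadicMaximal hF x hρ (by positivity)) _
    _ = _ := by
        rw [ENNReal.tsum_mul_right, ENNReal.tsum_mul_right, ← ENNReal.ofReal_tsum_of_nonneg
          (fun k => mul_nonneg (hw0 k) (by positivity)) hsum]
        rfl

/-! ### Integrals of powers of 1 + τ² with exponential damping -/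

lemma exists_exp_neg_le_one_add_rpow_neg (b : ℝ) :
    ∃ C : ℝ, 0 < C ∧ ∀ x : ℝ, 0 ≤ x → Real.exp (-x) ≤ C * (1 + x) ^ (-b) := by
  obtain ⟨n, hn⟩ := exists_nat_ge b
  refine ⟨n.factorial * Real.exp 1, by positivity, fun x hx => ?_⟩
  have h1 : (1 + x) ^ b ≤ (1 + x) ^ n := by
    rw [← Real.rpow_natCast]
    exact Real.rpow_le_rpow_of_exponent_le (by linarith) hn
  have h2 := Real.pow_div_factorial_le_exp (1 + x) (by linarith) n
  rw [div_le_iff₀ (by positivity)] at h2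
  rw [Real.rpow_neg (by linarith), ← div_eq_mul_inv, le_div_iff₀ (by positivity)]
  calc Real.exp (-x) * (1 + x) ^ b ≤ Real.exp (-x) * (Real.exp (1 + x) * n.factorial) := by
        gcongr; exact h1.trans h2
    _ = n.factorial * Real.exp 1 := by
        rw [← mul_assoc, ← Real.exp_add]; ring_nf

lemma integrable_one_add_sq_rpow {b : ℝ} (hb : 1 / 2 < b) :
    Integrable fun τ : ℝ => (1 + τ ^ 2) ^ (-b) := by
  have h := integrable_rpow_neg_one_add_norm_sq (E := ℝ) (μ := volume) (r := 2 * b)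
    (by simp; linarith)
  refine h.congr (ae_of_all _ fun τ => ?_)
  simp only [Real.norm_eq_abs, sq_abs]
  congr 1; ring

lemma integrable_const_add_sq_rpow {b : ℝ} (hb : 1 / 2 < b) {M : ℝ} (hM : 0 < M) :
    Integrable (fun τ : ℝ => (M + τ ^ 2) ^ (-b)) ∧
    ∫ τ : ℝ, (M + τ ^ 2) ^ (-b) = M ^ (1 / 2 - b) * ∫ τ : ℝ, (1 + τ ^ 2) ^ (-b) := by
  have hs : 0 < √M := Real.sqrt_pos.2 hM
  have e : ∀ τ : ℝ, (M + τ ^ 2) ^ (-b) = M ^ (-b) * (1 + ((√M)⁻¹ * τ) ^ 2) ^ (-b) := by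
    intro τ
    rw [← Real.mul_rpow hM.le (by positivity), mul_pow, inv_pow, Real.sq_sqrt hM.le]
    congr 1; field_simp
  simp only [e]
  constructor
  · exact ((integrable_one_add_sq_rpow hb).comp_mul_left' (inv_pos.2 hs).ne').const_mul _
  · rw [integral_const_mul,
      Measure.integral_comp_mul_left (fun τ : ℝ => (1 + τ ^ 2) ^ (-b)) (√M)⁻¹, inv_inv,
      abs_of_pos hs, smul_eq_mul, ← mul_assoc]
    congr 1
    rw [Real.sqrt_eq_rpow, ← Real.rpow_add hM]
    congr 1; ring

/-- Trading the exponential for a power merges both factors, since `(1 + τ²)(1 + N/(1 + τ²)) = 1 + N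
+ τ²`. Integration in τ then reduces to a scaling. -/
lemma exp_neg_div_le {C b : ℝ} (h : ∀ x : ℝ, 0 ≤ x → Real.exp (-x) ≤ C * (1 + x) ^ (-b))
    {N : ℝ} (hN : 0 ≤ N) (τ : ℝ) :
    (1 + τ ^ 2) ^ (-b) * Real.exp (-(N / (1 + τ ^ 2))) ≤ C * ((1 + N) + τ ^ 2) ^ (-b) := by
  have hp : 0 < 1 + τ ^ 2 := by positivity
  calc _ ≤ (1 + τ ^ 2) ^ (-b) * (C * (1 + N / (1 + τ ^ 2)) ^ (-b)) := by
        gcongr; exact h _ (by positivity)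
    _ = C * ((1 + τ ^ 2) ^ (-b) * (1 + N / (1 + τ ^ 2)) ^ (-b)) := by ring
    _ = _ := by
        rw [← Real.mul_rpow hp.le (by positivity)]
        congr 2; field_simp; ring

lemma integrable_one_add_sq_rpow_mul_exp {b : ℝ} (hb : 1 / 2 < b) {N : ℝ} (hN : 0 ≤ N) :
    Integrable fun τ : ℝ => (1 + τ ^ 2) ^ (-b) * Real.exp (-(N / (1 + τ ^ 2))) := by
  refine (integrable_one_add_sq_rpow hb).mono' ?_ (ae_of_all _ fun τ => ?_)
  · exact (by fun_prop : Measurable _).aestronglyMeasurable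
  · have hp : 0 < 1 + τ ^ 2 := by positivity
    rw [Real.norm_of_nonneg (by positivity)]
    refine mul_le_of_le_one_right (by positivity) (Real.exp_le_one_iff.2 ?_)
    rw [Left.neg_nonpos_iff]; positivity

lemma exists_integral_one_add_sq_rpow_mul_exp_le {b : ℝ} (hb : 1 / 2 < b) :
    ∃ C : ℝ, 0 < C ∧ ∀ N : ℝ, 0 ≤ N →
      ∫ τ : ℝ, (1 + τ ^ 2) ^ (-b) * Real.exp (-(N / (1 + τ ^ 2))) ≤ C * (1 + N) ^ (1 / 2 - b) := by
  obtain ⟨C, hC, h⟩ := exists_exp_neg_le_one_add_rpow_neg b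
  have hI : 0 ≤ ∫ τ : ℝ, (1 + τ ^ 2) ^ (-b) := integral_nonneg fun τ => by positivity
  refine ⟨C * ((∫ τ : ℝ, (1 + τ ^ 2) ^ (-b)) + 1), by positivity, fun N hN => ?_⟩
  obtain ⟨h1, h2⟩ := integrable_const_add_sq_rpow hb (show 0 < 1 + N by linarith)
  calc _ ≤ ∫ τ : ℝ, C * ((1 + N) + τ ^ 2) ^ (-b) :=
        integral_mono (integrable_one_add_sq_rpow_mul_exp hb hN) (h1.const_mul _)
          fun τ => exp_neg_div_le h hN τ
    _ = C * ((∫ τ : ℝ, (1 + τ ^ 2) ^ (-b))) * (1 + N) ^ (1 / 2 - b) := by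
        rw [integral_const_mul, h2]; ring
    _ ≤ _ := by gcongr; linarith

/-! ### Decay of the `T T*` kernel -/

/-- The exponent `y² / (1 + iτ) + y'² / (1 - iτ)`. -/
noncomputable def gaussianPhase (y y' τ : ℝ) : ℂ :=
  (y : ℂ) ^ 2 / (1 + τ * Complex.I) + (y' : ℂ) ^ 2 / (1 - τ * Complex.I)

/-- The kernel of `T T*` for the family of Gaussian averages along the line `Re z = 1`. -/
noncomputable def gaussianKernel (a y y' : ℝ) : ℂ :=
  ∫ τ : ℝ, (((1 + τ ^ 2) ^ (-(a + 1 / 2)) : ℝ) : ℂ) * Complex.exp (-gaussianPhase y y' τ)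

lemma one_add_mul_I_ne_zero (τ : ℝ) : (1 + τ * Complex.I : ℂ) ≠ 0 := by
  intro h; simpa using congrArg Complex.re h

lemma one_sub_mul_I_ne_zero (τ : ℝ) : (1 - τ * Complex.I : ℂ) ≠ 0 := by
  intro h; simpa using congrArg Complex.re h

lemma one_add_mul_I_mul_one_sub (τ : ℝ) :
    (1 + τ * Complex.I : ℂ) * (1 - τ * Complex.I) = ((1 + τ ^ 2 : ℝ) : ℂ) := by
  push_cast; linear_combination (-(τ : ℂ) ^ 2) * Complex.I_sq

lemma gaussianPhase_eq (y y' τ : ℝ) : gaussianPhase y y' τ =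
    (((y ^ 2 + y' ^ 2) / (1 + τ ^ 2) : ℝ) : ℂ) +
      ((-(τ * (y ^ 2 - y' ^ 2)) / (1 + τ ^ 2) : ℝ) : ℂ) * Complex.I := by
  have h1 := one_add_mul_I_ne_zero τ
  have h2 := one_sub_mul_I_ne_zero τ
  have h3 : ((1 + τ ^ 2 : ℝ) : ℂ) ≠ 0 := by
    exact_mod_cast (by positivity : (1 + τ ^ 2 : ℝ) ≠ 0)
  rw [gaussianPhase, div_add_div _ _ h1 h2, one_add_mul_I_mul_one_sub, Complex.ofReal_div,
    Complex.ofReal_div, div_mul_eq_mul_div, ← add_div]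
  congr 1
  push_cast; ring

lemma norm_exp_neg_gaussianPhase (y y' τ : ℝ) :
    ‖Complex.exp (-gaussianPhase y y' τ)‖ = Real.exp (-((y ^ 2 + y' ^ 2) / (1 + τ ^ 2))) := by
  rw [Complex.norm_exp, gaussianPhase_eq]
  simp only [Complex.neg_re, Complex.add_re, Complex.ofReal_re, Complex.re_ofReal_mul,
    Complex.I_re, mul_zero, add_zero]

lemma norm_exp_neg_gaussianPhase_le_one (y y' τ : ℝ) :
    ‖Complex.exp (-gaussianPhase y y' τ)‖ ≤ 1 := by
  rw [norm_exp_neg_gaussianPhase, Real.exp_le_one_iff, Left.neg_nonpos_iff]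
  positivity

lemma hasDerivAt_gaussianPhase (y y' τ : ℝ) :
    HasDerivAt (gaussianPhase y y')
      (Complex.I * ((-(y ^ 2 - y' ^ 2) * (1 - τ ^ 2) : ℝ) + (2 * τ * (y ^ 2 + y' ^ 2) : ℝ) *
        Complex.I) / ((1 + τ ^ 2 : ℝ) : ℂ) ^ 2) τ := by
  have h1 := one_add_mul_I_ne_zero τ
  have h2 := one_sub_mul_I_ne_zero τ
  have hid : HasDerivAt (fun t : ℝ => (t : ℂ) * Complex.I) Complex.I τ := by
    simpa using (Complex.ofRealCLM.hasDerivAt (x := τ)).mul_const Complex.I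
  have h3 := ((hasDerivAt_const τ ((y : ℂ) ^ 2)).div (hid.const_add 1) h1).add
    ((hasDerivAt_const τ ((y' : ℂ) ^ 2)).div (hid.const_sub 1) h2)
  refine h3.congr_deriv ?_
  rw [← one_add_mul_I_mul_one_sub]
  field_simp
  push_cast
  have := Complex.I_sq
  grind

/-- The phase has no stationary point off the diagonal. Since `y² + y'² ≥ |y² - y'²|`, the squared
modulus is at least `(y² - y'²)² ((1 - τ²)² + 4τ²)`, and the last factor is `(1 + τ²)²`. -/
lemma abs_sq_sub_sq_mul_le_norm {y y' : ℝ} (τ : ℝ) :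
    |y ^ 2 - y' ^ 2| * (1 + τ ^ 2) ≤ ‖(((-(y ^ 2 - y' ^ 2) * (1 - τ ^ 2) : ℝ) : ℂ) +
      (2 * τ * (y ^ 2 + y' ^ 2) : ℝ) * Complex.I)‖ := by
  rw [Complex.norm_add_mul_I]
  refine Real.le_sqrt_of_sq_le ?_
  rw [mul_pow, sq_abs]
  nlinarith [mul_nonneg (mul_nonneg (sq_nonneg y) (sq_nonneg y')) (sq_nonneg τ)]

lemma norm_gaussianKernel_le_integral (a y y' : ℝ) :
    ‖gaussianKernel a y y'‖ ≤ ∫ τ : ℝ, (1 + τ ^ 2) ^ (-(a + 1 / 2)) *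
      Real.exp (-((y ^ 2 + y' ^ 2) / (1 + τ ^ 2))) := by
  refine (norm_integral_le_integral_norm _).trans (le_of_eq ?_)
  congr 1; ext τ
  rw [norm_mul, norm_exp_neg_gaussianPhase, Complex.norm_real, Real.norm_of_nonneg (by positivity)]

lemma continuous_gaussianPhase (y y' : ℝ) : Continuous (gaussianPhase y y') :=
  continuous_iff_continuousAt.2 fun τ => (hasDerivAt_gaussianPhase y y' τ).continuousAt

/-- The decay of the kernel away from the diagonal, obtained by integrating by parts once. -/
lemma norm_gaussianKernel_le_of_ne {a : ℝ} (ha : 1 / 2 < a) {y y' : ℝ} (hD : y ^ 2 - y' ^ 2 ≠ 0) :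
    ‖gaussianKernel a y y'‖ ≤
      (|3 - 2 * a| + 2) / |y ^ 2 - y' ^ 2| * (∫ τ : ℝ, (1 + τ ^ 2) ^ (-a) *
        Real.exp (-((y ^ 2 + y' ^ 2) / (1 + τ ^ 2)))) +
      2 * (y ^ 2 + y' ^ 2) / |y ^ 2 - y' ^ 2| ^ 2 * ∫ τ : ℝ, (1 + τ ^ 2) ^ (-(a + 1 / 2)) *
        Real.exp (-((y ^ 2 + y' ^ 2) / (1 + τ ^ 2))) := by
  set D := y ^ 2 - y' ^ 2 with hDdef
  set N := y ^ 2 + y' ^ 2 with hN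
  have hN0 : 0 ≤ N := by positivity
  have hD0 : 0 < |D| := abs_pos.2 hD
  -- The derivative of the phase is `i P / (1 + τ²)²`.
  set P : ℝ → ℂ := fun τ => ((-D * (1 - τ ^ 2) : ℝ) : ℂ) + (2 * τ * N : ℝ) * Complex.I with hP
  have hPle : ∀ τ, |D| * (1 + τ ^ 2) ≤ ‖P τ‖ := fun τ => abs_sq_sub_sq_mul_le_norm τ
  have hP0 : ∀ τ, P τ ≠ 0 := fun τ => norm_pos_iff.1
    (lt_of_lt_of_le (mul_pos hD0 (by positivity)) (hPle τ))
  set P' : ℝ → ℂ := fun τ => ((2 * D * τ : ℝ) : ℂ) + (2 * N : ℝ) * Complex.I with hP'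
  have hPd : ∀ τ, HasDerivAt P (P' τ) τ := by
    intro τ
    have h1 : HasDerivAt (fun τ : ℝ => -D * (1 - τ ^ 2)) (2 * D * τ) τ := by
      refine (((hasDerivAt_pow 2 τ).const_sub 1).const_mul (-D)).congr_deriv ?_
      simp; ring
    have h2 : HasDerivAt (fun τ : ℝ => 2 * τ * N) (2 * N) τ := by
      refine (((hasDerivAt_id τ).const_mul 2).mul_const N).congr_deriv ?_
      simp
    exact h1.ofReal_comp.add (h2.ofReal_comp.mul_const Complex.I)
  have hw : ∀ τ : ℝ, 0 < 1 + τ ^ 2 := fun τ => by positivity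
  have hwd : ∀ τ : ℝ, HasDerivAt (fun τ : ℝ => ((((1 + τ ^ 2) ^ (3 / 2 - a) : ℝ) : ℂ)))
      (((3 - 2 * a) * τ * (1 + τ ^ 2) ^ (1 / 2 - a) : ℝ) : ℂ) τ := by
    intro τ
    refine HasDerivAt.ofReal_comp ?_
    refine (((hasDerivAt_pow 2 τ).const_add 1).rpow_const (Or.inl (hw τ).ne')).congr_deriv ?_
    rw [show 3 / 2 - a - 1 = 1 / 2 - a by ring]
    push_cast; ring
  set Q' : ℝ → ℂ := fun τ => Complex.I *
    (((((3 - 2 * a) * τ * (1 + τ ^ 2) ^ (1 / 2 - a) : ℝ) : ℂ) * P τ -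
      (((1 + τ ^ 2) ^ (3 / 2 - a) : ℝ) : ℂ) * P' τ) / P τ ^ 2) with hQ'
  have hQd : ∀ τ, HasDerivAt (fun τ : ℝ => Complex.I *
      ((((1 + τ ^ 2) ^ (3 / 2 - a) : ℝ) : ℂ) / P τ)) (Q' τ) τ := fun τ =>
    ((hwd τ).div (hPd τ) (hP0 τ)).const_mul Complex.I
  set e : ℝ → ℂ := fun τ => Complex.exp (-gaussianPhase y y' τ) with he
  have hed : ∀ τ, HasDerivAt e (e τ * -(Complex.I * P τ / ((1 + τ ^ 2 : ℝ) : ℂ) ^ 2)) τ :=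
    fun τ => (hasDerivAt_gaussianPhase y y' τ).neg.cexp
  have hone : ∀ τ, ‖e τ‖ ≤ 1 := norm_exp_neg_gaussianPhase_le_one y y'
  -- The integration by parts: dividing by the phase derivative turns the weight into `(1 + τ²)^(3/2
  -- - a) / P`. Differentiating the exponential gives back the integrand of the kernel, and
  -- differentiating the amplitude gives the error `Q'`.
  have hmain : ∀ τ, HasDerivAt (fun τ : ℝ => Complex.I *
      ((((1 + τ ^ 2) ^ (3 / 2 - a) : ℝ) : ℂ) / P τ) * e τ)
      (Q' τ * e τ + (((1 + τ ^ 2) ^ (-(a + 1 / 2)) : ℝ) : ℂ) * e τ) τ := by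
    intro τ
    refine ((hQd τ).mul (hed τ)).congr_deriv ?_
    congr 1
    have hr : (1 + τ ^ 2) ^ (3 / 2 - a) = (1 + τ ^ 2) ^ (-(a + 1 / 2)) * (1 + τ ^ 2) ^ 2 := by
      rw [← Real.rpow_natCast (1 + τ ^ 2) 2, ← Real.rpow_add (hw τ)]
      congr 1; push_cast; ring
    have hwc : ((1 + τ ^ 2 : ℝ) : ℂ) ≠ 0 := by exact_mod_cast (hw τ).ne'
    rw [hr, Complex.ofReal_mul, Complex.ofReal_pow]
    have := hP0 τ
    field_simp
    rw [Complex.I_sq]; ring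
  have hsq : ∀ τ : ℝ, |τ| ≤ (1 + τ ^ 2) ^ (1 / 2 : ℝ) := by
    intro τ
    rw [← Real.sqrt_eq_rpow]
    exact Real.le_sqrt_of_sq_le (by rw [sq_abs]; linarith)
  have hQle : ∀ τ, ‖Q' τ‖ ≤ (|3 - 2 * a| + 2) / |D| * (1 + τ ^ 2) ^ (-a) +
      2 * N / |D| ^ 2 * (1 + τ ^ 2) ^ (-(a + 1 / 2)) := by
    intro τ
    have hp' : ‖P' τ‖ ≤ 2 * |D| * |τ| + 2 * N := by
      refine (norm_add_le _ _).trans (add_le_add ?_ ?_)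
      · rw [Complex.norm_real, Real.norm_eq_abs, abs_mul, abs_mul]; simp
      · rw [norm_mul, Complex.norm_I, Complex.norm_real, mul_one, Real.norm_of_nonneg (by positivity)]
    have r1 : (1 + τ ^ 2) ^ (1 / 2 - a) * (1 + τ ^ 2) ^ (1 / 2 : ℝ) =
        (1 + τ ^ 2) ^ (-a) * (1 + τ ^ 2) := by
      nth_rewrite 4 [← Real.rpow_one (1 + τ ^ 2)]
      rw [← Real.rpow_add (hw τ), ← Real.rpow_add (hw τ)]; congr 1; ring
    have r2 : (1 + τ ^ 2) ^ (3 / 2 - a) * (1 + τ ^ 2) ^ (1 / 2 : ℝ) =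
        (1 + τ ^ 2) ^ (-a) * (1 + τ ^ 2) ^ 2 := by
      rw [← Real.rpow_natCast (1 + τ ^ 2) 2, ← Real.rpow_add (hw τ), ← Real.rpow_add (hw τ)]
      congr 1; push_cast; ring
    have r3 : (1 + τ ^ 2) ^ (3 / 2 - a) = (1 + τ ^ 2) ^ (-(a + 1 / 2)) * (1 + τ ^ 2) ^ 2 := by
      rw [← Real.rpow_natCast (1 + τ ^ 2) 2, ← Real.rpow_add (hw τ)]
      congr 1; push_cast; ring
    have hw' := hw τ
    have t1 : ‖(((3 - 2 * a) * τ * (1 + τ ^ 2) ^ (1 / 2 - a) : ℝ) : ℂ) / P τ‖ ≤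
        |3 - 2 * a| / |D| * (1 + τ ^ 2) ^ (-a) := by
      rw [norm_div, Complex.norm_real, Real.norm_eq_abs, abs_mul, abs_mul,
        abs_of_nonneg (Real.rpow_nonneg (hw τ).le _)]
      calc _ ≤ |3 - 2 * a| * (1 + τ ^ 2) ^ (1 / 2 : ℝ) * (1 + τ ^ 2) ^ (1 / 2 - a) /
            (|D| * (1 + τ ^ 2)) := by
            gcongr
            · exact hsq τ
            · exact hPle τ
        _ = _ := by
            rw [mul_assoc, mul_comm ((1 + τ ^ 2) ^ (1 / 2 : ℝ)), r1]
            field_simp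
    have t2 : ‖((((1 + τ ^ 2) ^ (3 / 2 - a) : ℝ) : ℂ) * P' τ) / P τ ^ 2‖ ≤
        2 / |D| * (1 + τ ^ 2) ^ (-a) + 2 * N / |D| ^ 2 * (1 + τ ^ 2) ^ (-(a + 1 / 2)) := by
      rw [norm_div, norm_mul, norm_pow, Complex.norm_real,
        Real.norm_of_nonneg (Real.rpow_nonneg (hw τ).le _)]
      calc _ ≤ (1 + τ ^ 2) ^ (3 / 2 - a) * (2 * |D| * (1 + τ ^ 2) ^ (1 / 2 : ℝ) + 2 * N) /
            (|D| * (1 + τ ^ 2)) ^ 2 := by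
            gcongr
            · refine hp'.trans ?_
              gcongr
              exact hsq τ
            · exact hPle τ
        _ = (2 * |D| * ((1 + τ ^ 2) ^ (3 / 2 - a) * (1 + τ ^ 2) ^ (1 / 2 : ℝ)) +
            2 * N * (1 + τ ^ 2) ^ (3 / 2 - a)) / (|D| * (1 + τ ^ 2)) ^ 2 := by ring
        _ = _ := by
            rw [r2, r3]
            field_simp
    have e1 : Q' τ = Complex.I * ((((3 - 2 * a) * τ * (1 + τ ^ 2) ^ (1 / 2 - a) : ℝ) : ℂ) / P τ -
        ((((1 + τ ^ 2) ^ (3 / 2 - a) : ℝ) : ℂ) * P' τ) / P τ ^ 2) := by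
      rw [hQ']
      simp only
      rw [sub_div, pow_two (P τ), mul_div_mul_right _ _ (hP0 τ)]
    rw [e1, norm_mul, Complex.norm_I, one_mul]
    refine (norm_sub_le _ _).trans ((add_le_add t1 t2).trans (le_of_eq ?_))
    ring
  have hec : Continuous e := (continuous_gaussianPhase y y').neg.cexp
  have hi2 : Integrable fun τ : ℝ => (((1 + τ ^ 2) ^ (-(a + 1 / 2)) : ℝ) : ℂ) * e τ := by
    refine (integrable_one_add_sq_rpow (b := a + 1 / 2) (by linarith)).mono' ?_
      (ae_of_all _ fun τ => ?_)
    · exact (by fun_prop : Measurable _).aestronglyMeasurable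
    · rw [norm_mul, Complex.norm_real, Real.norm_of_nonneg (by have := hw τ; positivity)]
      exact mul_le_of_le_one_right (by have := hw τ; positivity) (hone τ)
  have hg1 := (integrable_one_add_sq_rpow_mul_exp ha hN0).const_mul ((|3 - 2 * a| + 2) / |D|)
  have hg2 := (integrable_one_add_sq_rpow_mul_exp (b := a + 1 / 2) (by linarith) hN0).const_mul
    (2 * N / |D| ^ 2)
  have hle : ∀ τ, ‖Q' τ * e τ‖ ≤ (|3 - 2 * a| + 2) / |D| * ((1 + τ ^ 2) ^ (-a) *
        Real.exp (-(N / (1 + τ ^ 2)))) +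
      2 * N / |D| ^ 2 * ((1 + τ ^ 2) ^ (-(a + 1 / 2)) * Real.exp (-(N / (1 + τ ^ 2)))) := by
    intro τ
    rw [norm_mul, norm_exp_neg_gaussianPhase, ← mul_assoc, ← mul_assoc, ← add_mul]
    exact mul_le_mul_of_nonneg_right (hQle τ) (Real.exp_nonneg _)
  have hi1 : Integrable fun τ => Q' τ * e τ := by
    refine (hg1.add hg2).mono' ?_ (ae_of_all _ hle)
    have hPm : Measurable P := by
      exact (continuous_iff_continuousAt.2 fun τ => (hPd τ).continuousAt).measurable
    have hem := hec.measurable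
    exact (by fun_prop : Measurable fun τ => Q' τ * e τ).aestronglyMeasurable
  -- The boundary terms are of size `|D|⁻¹ (1 + τ²)^(1/2 - a)` and vanish because `a > 1/2`.
  -- Requiring only that τ² tends to infinity covers both ends at once.
  have htend : ∀ l : Filter ℝ, Filter.Tendsto (fun τ : ℝ => τ ^ 2) l Filter.atTop →
      Filter.Tendsto (fun τ : ℝ => Complex.I *
        ((((1 + τ ^ 2) ^ (3 / 2 - a) : ℝ) : ℂ) / P τ) * e τ) l (nhds 0) := by
    intro l hl
    have h1 : Filter.Tendsto (fun τ : ℝ => |D|⁻¹ * (1 + τ ^ 2) ^ (-(a - 1 / 2))) l (nhds 0) := by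
      have := ((tendsto_rpow_neg_atTop (show 0 < a - 1 / 2 by linarith)).comp
        (Filter.tendsto_atTop_add_const_left _ 1 hl)).const_mul |D|⁻¹
      simpa using this
    refine squeeze_zero_norm (fun τ => ?_) h1
    have r3 : (1 + τ ^ 2) ^ (3 / 2 - a) = (1 + τ ^ 2) ^ (-(a - 1 / 2)) * (1 + τ ^ 2) := by
      nth_rewrite 3 [← Real.rpow_one (1 + τ ^ 2)]
      rw [← Real.rpow_add (hw τ)]
      congr 1; ring
    have hw' := hw τ
    rw [norm_mul, norm_mul, Complex.norm_I, one_mul, norm_div, Complex.norm_real,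
      Real.norm_of_nonneg (Real.rpow_nonneg (hw τ).le _)]
    calc _ ≤ (1 + τ ^ 2) ^ (3 / 2 - a) / (|D| * (1 + τ ^ 2)) * 1 := by
          gcongr
          · exact hPle τ
          · exact hone τ
      _ = _ := by rw [r3]; field_simp
  have hzero := integral_of_hasDerivAt_of_tendsto hmain (hi1.add hi2)
    (htend _ (by simpa using Filter.tendsto_atBot_atTop.2 fun b => ⟨-(|b| + 1), fun x hx => by
      nlinarith [abs_nonneg b, le_abs_self b]⟩)) (htend _ (Filter.tendsto_pow_atTop two_ne_zero))
  rw [integral_add hi1 hi2, sub_zero] at hzero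
  have hK : gaussianKernel a y y' = -∫ τ, Q' τ * e τ := by
    rw [gaussianKernel]; linear_combination hzero
  rw [hK, norm_neg, ← integral_const_mul, ← integral_const_mul, ← integral_add hg1 hg2]
  exact norm_integral_le_of_norm_le (hg1.add hg2) (ae_of_all _ hle)

/-- Let `N = y² + y'²` and `d = ||y| - |y'||`. For `d < 1` the absolute-value bound suffices. For `d
≥ 1`, integration by parts costs a factor `N^(1/2)` in its first term, which is recovered from `|y²
- y'²| ≥ d √N`; the second term is even of order `d⁻²`. -/
lemma exists_norm_gaussianKernel_le {a : ℝ} (ha : 1 / 2 < a) :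
    ∃ C : ℝ, 0 < C ∧ ∀ y y' : ℝ, ‖gaussianKernel a y y'‖ ≤
      C * ((1 + (y ^ 2 + y' ^ 2)) ^ (-a) * (1 + |(|y| - |y'|)|)⁻¹) := by
  obtain ⟨C₁, hC₁, h₁⟩ := exists_integral_one_add_sq_rpow_mul_exp_le ha
  obtain ⟨C₂, hC₂, h₂⟩ := exists_integral_one_add_sq_rpow_mul_exp_le
    (show 1 / 2 < a + 1 / 2 by linarith)
  refine ⟨2 * ((|3 - 2 * a| + 2) * C₁ * 2 + 2 * C₂), by positivity, fun y y' => ?_⟩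
  set N := y ^ 2 + y' ^ 2 with hN
  have hN0 : 0 ≤ N := by positivity
  set d := |(|y| - |y'|)| with hd
  have hd0 : 0 ≤ d := abs_nonneg _
  have h₂' := h₂ N hN0
  rw [show 1 / 2 - (a + 1 / 2) = -a by ring] at h₂'
  have hA : 0 < (1 + N) ^ (-a) := by positivity
  rcases lt_or_ge d 1 with h | h
  · calc _ ≤ C₂ * (1 + N) ^ (-a) := (norm_gaussianKernel_le_integral a y y').trans h₂'
      _ = (2 * C₂) * ((1 + N) ^ (-a) * 2⁻¹) := by ring
      _ ≤ _ := by
        gcongr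
        · nlinarith [mul_nonneg (mul_nonneg (abs_nonneg (3 - 2 * a)) hC₁.le) zero_le_two]
        · linarith
  · have hdN : d ^ 2 ≤ N := by
      rw [hd, sq_abs, hN, ← sq_abs y, ← sq_abs y']
      nlinarith [abs_nonneg y, abs_nonneg y']
    have hDe : |y ^ 2 - y' ^ 2| = d * (|y| + |y'|) := by
      rw [hd, ← sq_abs y, ← sq_abs y', sq_sub_sq, abs_mul, mul_comm,
        abs_of_nonneg (by positivity : 0 ≤ |y| + |y'|)]
    have hsum : √N ≤ |y| + |y'| := by
      rw [Real.sqrt_le_left (by positivity), hN, ← sq_abs y, ← sq_abs y']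
      nlinarith [mul_nonneg (abs_nonneg y) (abs_nonneg y')]
    have hN1 : 1 ≤ N := by nlinarith
    have hs1 : 1 ≤ √N := Real.one_le_sqrt.2 hN1
    have hDle : d * √N ≤ |y ^ 2 - y' ^ 2| := by rw [hDe]; gcongr
    have hD0 : 0 < |y ^ 2 - y' ^ 2| := lt_of_lt_of_le (by positivity) hDle
    have hD2 : d ^ 2 * N ≤ |y ^ 2 - y' ^ 2| ^ 2 := by
      calc d ^ 2 * N = (d * √N) ^ 2 := by rw [mul_pow, Real.sq_sqrt hN0]
        _ ≤ _ := by gcongr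
    have hd' : 0 < d := by linarith
    have hr : (1 + N) ^ (1 / 2 - a) ≤ 2 * √N * (1 + N) ^ (-a) := by
      rw [sub_eq_add_neg, Real.rpow_add (by linarith), ← Real.sqrt_eq_rpow]
      gcongr
      rw [Real.sqrt_le_left (by positivity), mul_pow, Real.sq_sqrt hN0]
      linarith
    refine (norm_gaussianKernel_le_of_ne ha (abs_pos.1 hD0)).trans ?_
    calc _ ≤ (|3 - 2 * a| + 2) / (d * √N) * (C₁ * (2 * √N * (1 + N) ^ (-a))) +
          2 * N / (d ^ 2 * N) * (C₂ * (1 + N) ^ (-a)) := by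
          gcongr
          exact (h₁ N hN0).trans (by gcongr)
      _ = ((|3 - 2 * a| + 2) * C₁ * 2 + 2 * C₂ * d⁻¹) * ((1 + N) ^ (-a) * d⁻¹) := by
          field_simp
      _ ≤ ((|3 - 2 * a| + 2) * C₁ * 2 + 2 * C₂ * 1) * ((1 + N) ^ (-a) * (2 * (1 + d)⁻¹)) := by
          gcongr
          · exact inv_le_one_of_one_le₀ h
          · rw [← div_eq_mul_inv, inv_eq_one_div, div_le_div_iff₀ hd' (by linarith)]; linarith
      _ = _ := by ring

/-! ### A Young-type bilinear inequality -/

lemma one_add_abs_abs_sub_rpow_le {r : ℝ} (y y' : ℝ) :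
    (1 + |(|y| - |y'|)|) ^ (-r) ≤ (1 + |y' - y|) ^ (-r) + (1 + |y' + y|) ^ (-r) := by
  have h1 : 0 ≤ (1 + |y' - y|) ^ (-r) := by positivity
  have h2 : 0 ≤ (1 + |y' + y|) ^ (-r) := by positivity
  rcases abs_choice y with hy | hy <;> rcases abs_choice y' with hy' | hy' <;> rw [hy, hy']
  · rw [abs_sub_comm y y']; linarith
  · rw [show y - -y' = y' + y by ring]; linarith
  · rw [show -y - y' = -(y' + y) by ring, abs_neg]; linarith
  · rw [show -y - -y' = y' - y by ring]; linarith

lemma exists_lintegral_one_add_abs_abs_sub_le {r : ℝ} (hr : 1 < r) :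
    ∃ C : ℝ≥0, ∀ y : ℝ,
      ∫⁻ y', ENNReal.ofReal ((1 + |(|y| - |y'|)|) ^ (-r)) ≤ C := by
  have hi : Integrable fun v : ℝ => (1 + |v|) ^ (-r) := by
    simpa using integrable_one_add_norm (E := ℝ) (μ := volume) (r := r) (by simpa using hr)
  refine ⟨(∫⁻ v : ℝ, ENNReal.ofReal ((1 + |v|) ^ (-r))).toNNReal * 2, fun y => ?_⟩
  have hfin : ∫⁻ v : ℝ, ENNReal.ofReal ((1 + |v|) ^ (-r)) ≠ ∞ := hi.lintegral_lt_top.ne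
  rw [ENNReal.coe_mul, ENNReal.coe_toNNReal hfin]
  calc _ ≤ ∫⁻ y', (ENNReal.ofReal ((1 + |y' - y|) ^ (-r)) +
        ENNReal.ofReal ((1 + |y' + y|) ^ (-r))) := by
        refine lintegral_mono fun y' => ?_
        rw [← ENNReal.ofReal_add (by positivity) (by positivity)]
        exact ENNReal.ofReal_le_ofReal (one_add_abs_abs_sub_rpow_le y y')
    _ = _ := by
        rw [lintegral_add_left (by fun_prop),
          lintegral_sub_right_eq_self (fun v : ℝ => ENNReal.ofReal ((1 + |v|) ^ (-r))) y,
          lintegral_add_right_eq_self (fun v : ℝ => ENNReal.ofReal ((1 + |v|) ^ (-r))) y,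
          ENNReal.coe_ofNat, mul_two]

/-- A bilinear form of Young type. -/
lemma exists_lintegral_mul_mul_inv_one_add_le {s : ℝ} (hs1 : 1 < s) (hs2 : s < 2) :
    ∃ C : ℝ≥0, ∀ h : ℝ → ℝ≥0∞, Measurable h →
      ∫⁻ p : ℝ × ℝ, h p.1 * h p.2 * ENNReal.ofReal ((1 + |(|p.1| - |p.2|)|)⁻¹) ≤
        C * (∫⁻ y, h y ^ s) ^ (2 / s) := by
  have hs0 : 0 < s := by linarith
  -- Exponents of a three-factor Hölder inequality with `A + 2B = 1`. The kernel is measured in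
  -- `L^r` with `r = 1/(2B)`, and it lies there because `r > 1`, which is equivalent to `s < 2`.
  -- Also `A + B = 1/s`, whence the final exponent `2/s`.
  set A := 2 / s - 1 with hA
  set B := 1 - 1 / s with hB
  have hA0 : 0 < A := by rw [hA, sub_pos, lt_div_iff₀ hs0]; linarith
  have hB0 : 0 < B := by rw [hB, sub_pos, div_lt_iff₀ hs0]; linarith
  set r := 1 / (2 * B) with hr
  have hr1 : 1 < r := by
    rw [hr, lt_div_iff₀ (by positivity)]
    have : 2 / s = 2 * (1 / s) := by ring
    linarith
  obtain ⟨C, hC⟩ := exists_lintegral_one_add_abs_abs_sub_le hr1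
  have hAB : s * A + s * B = 1 := by rw [hA, hB]; field_simp; ring
  have hrB : r * B + r * B = 1 := by rw [hr]; field_simp; ring
  have hr0 : 0 < r := by linarith
  have hCt : (C : ℝ≥0∞) ^ (2 * B) ≠ ∞ :=
    ENNReal.rpow_ne_top_of_nonneg (by positivity) ENNReal.coe_ne_top
  refine ⟨((C : ℝ≥0∞) ^ (2 * B)).toNNReal, fun h hh => ?_⟩
  rw [ENNReal.coe_toNNReal hCt]
  set I := ∫⁻ y, h y ^ s with hI
  set Λ : ℝ × ℝ → ℝ≥0∞ := fun p => ENNReal.ofReal ((1 + |(|p.1| - |p.2|)|)⁻¹) with hΛ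
  have hΛm : Measurable Λ := by fun_prop
  have hΛr : ∀ p, Λ p ^ r = ENNReal.ofReal ((1 + |(|p.1| - |p.2|)|) ^ (-r)) := by
    intro p
    rw [hΛ]
    simp only
    rw [ENNReal.ofReal_rpow_of_nonneg (by positivity) hr0.le, Real.rpow_neg (by positivity),
      Real.inv_rpow (by positivity)]
  let f : Fin 3 → ℝ × ℝ → ℝ≥0∞ := ![fun p => h p.1 ^ s * h p.2 ^ s,
    fun p => h p.1 ^ s * Λ p ^ r, fun p => h p.2 ^ s * Λ p ^ r]
  have hfm : ∀ i, Measurable (f i) := by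
    intro i
    fin_cases i
    · show Measurable fun p : ℝ × ℝ => h p.1 ^ s * h p.2 ^ s
      fun_prop
    · show Measurable fun p : ℝ × ℝ => h p.1 ^ s * Λ p ^ r
      fun_prop
    · show Measurable fun p : ℝ × ℝ => h p.2 ^ s * Λ p ^ r
      fun_prop
  have hH : ∫⁻ p : ℝ × ℝ, (h p.1 ^ s * h p.2 ^ s) ^ A * (h p.1 ^ s * Λ p ^ r) ^ B *
      (h p.2 ^ s * Λ p ^ r) ^ B ≤ (∫⁻ p : ℝ × ℝ, h p.1 ^ s * h p.2 ^ s) ^ A *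
      (∫⁻ p : ℝ × ℝ, h p.1 ^ s * Λ p ^ r) ^ B * (∫⁻ p : ℝ × ℝ, h p.2 ^ s * Λ p ^ r) ^ B := by
    have := ENNReal.lintegral_prod_norm_pow_le (μ := (volume : Measure (ℝ × ℝ))) Finset.univ
      (f := f) (fun i _ => (hfm i).aemeasurable) (p := ![A, B, B])
      (by simp [Fin.sum_univ_three]; rw [hA, hB]; ring)
      (fun i _ => by fin_cases i <;> simp [hA0.le, hB0.le])
    simp only [Fin.prod_univ_three] at this
    exact this
  have hpt : ∀ p : ℝ × ℝ, (h p.1 ^ s * h p.2 ^ s) ^ A * (h p.1 ^ s * Λ p ^ r) ^ B *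
      (h p.2 ^ s * Λ p ^ r) ^ B = h p.1 * h p.2 * Λ p := by
    intro p
    simp only [ENNReal.mul_rpow_of_nonneg _ _ hA0.le, ENNReal.mul_rpow_of_nonneg _ _ hB0.le,
      ← ENNReal.rpow_mul]
    have e : ∀ (u : ℝ≥0∞), u ^ (s * A) * u ^ (s * B) = u := fun u => by
      rw [← ENNReal.rpow_add_of_nonneg _ _ (by positivity) (by positivity), hAB, ENNReal.rpow_one]
    have e' : ∀ (u : ℝ≥0∞), u ^ (r * B) * u ^ (r * B) = u := fun u => by
      rw [← ENNReal.rpow_add_of_nonneg _ _ (by positivity) (by positivity), hrB, ENNReal.rpow_one]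
    calc _ = (h p.1 ^ (s * A) * h p.1 ^ (s * B)) * (h p.2 ^ (s * A) * h p.2 ^ (s * B)) *
          (Λ p ^ (r * B) * Λ p ^ (r * B)) := by ring
      _ = _ := by rw [e, e, e']
  simp only [hpt] at hH
  have hhs : Measurable fun y => h y ^ s := by fun_prop
  have i0 : ∫⁻ p : ℝ × ℝ, h p.1 ^ s * h p.2 ^ s = I * I := by
    rw [Measure.volume_eq_prod, lintegral_prod_mul hhs.aemeasurable hhs.aemeasurable]
  have i1 : ∫⁻ p : ℝ × ℝ, h p.1 ^ s * Λ p ^ r ≤ C * I := by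
    rw [Measure.volume_eq_prod, lintegral_prod _ (by fun_prop), ← lintegral_const_mul _ hhs]
    refine lintegral_mono fun y => ?_
    simp only [hΛr]
    rw [lintegral_const_mul _ (by fun_prop), mul_comm]
    exact mul_le_mul_left (hC y) _
  have i2 : ∫⁻ p : ℝ × ℝ, h p.2 ^ s * Λ p ^ r ≤ C * I := by
    rw [Measure.volume_eq_prod, lintegral_prod_symm _ (by fun_prop), ← lintegral_const_mul _ hhs]
    refine lintegral_mono fun y => ?_
    simp only [hΛr]
    rw [lintegral_const_mul _ (by fun_prop), mul_comm]
    simp only [abs_sub_comm _ |y|]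
    exact mul_le_mul_left (hC y) _
  refine hH.trans ?_
  rw [i0]
  calc _ ≤ (I * I) ^ A * (C * I) ^ B * (C * I) ^ B := by gcongr
    _ = (C ^ B * C ^ B) * ((I ^ A * I ^ B) * (I ^ A * I ^ B)) := by
        simp only [ENNReal.mul_rpow_of_nonneg _ _ hA0.le, ENNReal.mul_rpow_of_nonneg _ _ hB0.le]
        ring
    _ = _ := by
        simp only [← ENNReal.rpow_add_of_nonneg _ _ hA0.le hB0.le,
          ← ENNReal.rpow_add_of_nonneg _ _ hB0.le hB0.le,
          ← ENNReal.rpow_add_of_nonneg _ _ (add_nonneg hA0.le hB0.le) (add_nonneg hA0.le hB0.le)]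
        congr 2
        · ring
        · rw [hA, hB]; ring

/-! ### Weighted mean-square bounds for Gaussian averages -/

/-- The Gaussian average `∫ g(y) e^{-y² / (1 + iτ)} dy`. -/
noncomputable def gaussianAverage (g : ℝ → ℂ) (τ : ℝ) : ℂ :=
  ∫ y : ℝ, g y * Complex.exp (-((y : ℂ) ^ 2 / (1 + τ * Complex.I)))

lemma ofReal_normSq_gaussianAverage (g : ℝ → ℂ) (τ : ℝ) :
    ((‖gaussianAverage g τ‖ ^ 2 : ℝ) : ℂ) = ∫ p : ℝ × ℝ,
      g p.1 * (starRingEnd ℂ) (g p.2) * Complex.exp (-gaussianPhase p.1 p.2 τ) := by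
  rw [Complex.ofReal_pow, ← Complex.mul_conj']
  have hc : (starRingEnd ℂ) (gaussianAverage g τ) = ∫ y : ℝ, (starRingEnd ℂ) (g y) *
      Complex.exp (-((y : ℂ) ^ 2 / (1 - τ * Complex.I))) := by
    rw [gaussianAverage, ← integral_conj]
    congr 1; ext y
    rw [map_mul, ← Complex.exp_conj]
    simp [sub_eq_add_neg]
  rw [hc, gaussianAverage, Measure.volume_eq_prod, ← integral_prod_mul]
  congr 1; ext p
  rw [gaussianPhase, neg_add, Complex.exp_add]
  ring

/-- Expanding the square and integrating in τ first (Fubini) leaves a bilinear form with the `T T*`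
kernel; its oscillation is used up in the kernel, so absolute values can now be taken. -/
lemma lintegral_gaussianAverage_le {a : ℝ} (ha : 0 < a) {g : ℝ → ℂ} (hg : Integrable g) :
    ∫⁻ τ : ℝ, ENNReal.ofReal ((1 + τ ^ 2) ^ (-(a + 1 / 2))) * ‖gaussianAverage g τ‖ₑ ^ 2 ≤
      ∫⁻ p : ℝ × ℝ, ‖g p.1‖ₑ * ‖g p.2‖ₑ * ‖gaussianKernel a p.1 p.2‖ₑ := by
  have hgg : Integrable (fun p : ℝ × ℝ => g p.1 * (starRingEnd ℂ) (g p.2)) := by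
    have h2 : Integrable fun y => (starRingEnd ℂ) (g y) :=
      (Complex.conjCLE : ℂ →L[ℝ] ℂ).integrable_comp hg
    exact hg.mul_prod h2
  have hw : Integrable fun τ : ℝ => (((1 + τ ^ 2) ^ (-(a + 1 / 2)) : ℝ) : ℂ) :=
    (integrable_one_add_sq_rpow (b := a + 1 / 2) (by linarith)).ofReal
  have hprod := hw.mul_prod hgg
  have hexpm : Measurable fun q : ℝ × ℝ × ℝ => Complex.exp (-gaussianPhase q.2.1 q.2.2 q.1) := by
    unfold gaussianPhase
    fun_prop
  have hint : Integrable (fun q : ℝ × ℝ × ℝ => (((1 + q.1 ^ 2) ^ (-(a + 1 / 2)) : ℝ) : ℂ) *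
      (g q.2.1 * (starRingEnd ℂ) (g q.2.2)) * Complex.exp (-gaussianPhase q.2.1 q.2.2 q.1))
      ((volume : Measure ℝ).prod (volume : Measure (ℝ × ℝ))) :=
    hprod.mul_bdd (c := 1) hexpm.aestronglyMeasurable
      (ae_of_all _ fun q => norm_exp_neg_gaussianPhase_le_one _ _ _)
  have hsq : ∀ τ : ℝ, ∫ p : ℝ × ℝ, (((1 + τ ^ 2) ^ (-(a + 1 / 2)) : ℝ) : ℂ) *
      (g p.1 * (starRingEnd ℂ) (g p.2)) * Complex.exp (-gaussianPhase p.1 p.2 τ) =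
      (((1 + τ ^ 2) ^ (-(a + 1 / 2)) * ‖gaussianAverage g τ‖ ^ 2 : ℝ) : ℂ) := by
    intro τ
    rw [Complex.ofReal_mul, ofReal_normSq_gaussianAverage, ← integral_const_mul]
    simp only [mul_assoc]
  have hreal : Integrable fun τ : ℝ =>
      (1 + τ ^ 2) ^ (-(a + 1 / 2)) * ‖gaussianAverage g τ‖ ^ 2 := by
    have h := hint.integral_prod_left
    simp only [hsq] at h
    exact h.re
  have hswap := integral_integral_swap (f := fun (τ : ℝ) (p : ℝ × ℝ) =>
    (((1 + τ ^ 2) ^ (-(a + 1 / 2)) : ℝ) : ℂ) * (g p.1 * (starRingEnd ℂ) (g p.2)) *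
      Complex.exp (-gaussianPhase p.1 p.2 τ)) hint
  simp only [hsq] at hswap
  have hnn : ∀ τ : ℝ, 0 ≤ (1 + τ ^ 2) ^ (-(a + 1 / 2)) * ‖gaussianAverage g τ‖ ^ 2 := fun τ => by
    positivity
  have hker : ∀ p : ℝ × ℝ, ∫ τ : ℝ, (((1 + τ ^ 2) ^ (-(a + 1 / 2)) : ℝ) : ℂ) *
      (g p.1 * (starRingEnd ℂ) (g p.2)) * Complex.exp (-gaussianPhase p.1 p.2 τ) =
      g p.1 * (starRingEnd ℂ) (g p.2) * gaussianKernel a p.1 p.2 := by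
    intro p
    rw [gaussianKernel, ← integral_const_mul]
    congr 1; ext τ; ring
  simp only [hker] at hswap
  calc _ = ENNReal.ofReal (∫ τ : ℝ,
        (1 + τ ^ 2) ^ (-(a + 1 / 2)) * ‖gaussianAverage g τ‖ ^ 2) := by
        rw [ofReal_integral_eq_lintegral_ofReal hreal (ae_of_all _ hnn)]
        congr 1; ext τ
        rw [ENNReal.ofReal_mul (by positivity), ENNReal.ofReal_pow (norm_nonneg _),
          ofReal_norm]
    _ = ‖∫ τ : ℝ, (((1 + τ ^ 2) ^ (-(a + 1 / 2)) * ‖gaussianAverage g τ‖ ^ 2 : ℝ) : ℂ)‖ₑ := by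
        rw [integral_complex_ofReal, ← ofReal_norm, Complex.norm_real,
          Real.norm_of_nonneg (integral_nonneg hnn)]
    _ ≤ _ := by
        rw [hswap]
        refine (enorm_integral_le_lintegral_enorm _).trans (le_of_eq ?_)
        congr 1; ext p
        rw [enorm_mul, enorm_mul]
        congr 2
        rw [← ofReal_norm, RCLike.norm_conj, ofReal_norm]

lemma one_add_sq_add_sq_rpow_neg_le {a : ℝ} (ha : 0 ≤ a) (y y' : ℝ) :
    (1 + (y ^ 2 + y' ^ 2)) ^ (-a) ≤ 2 ^ a * ((1 + |y|) ^ (-a) * (1 + |y'|) ^ (-a)) := by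
  have h : (1 + |y|) * (1 + |y'|) / 2 ≤ 1 + (y ^ 2 + y' ^ 2) := by
    rw [← sq_abs y, ← sq_abs y']
    nlinarith [sq_nonneg (|y| - |y'|), sq_nonneg (|y| - 1), sq_nonneg (|y'| - 1)]
  calc _ ≤ ((1 + |y|) * (1 + |y'|) / 2) ^ (-a) :=
        Real.rpow_le_rpow_of_nonpos (by positivity) h (by linarith)
    _ = _ := by
        rw [Real.div_rpow (by positivity) (by norm_num), Real.mul_rpow (by positivity)
          (by positivity), Real.rpow_neg (by norm_num : (0 : ℝ) ≤ 2), div_inv_eq_mul]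
        ring

/-- A weighted square function estimate for the Gaussian averages. -/
lemma exists_lintegral_gaussianAverage_sq_le {s a : ℝ} (hs1 : 1 < s) (hs2 : s < 2)
    (ha : 1 / 2 < a) :
    ∃ C : ℝ≥0, ∀ g : ℝ → ℂ, Integrable g → Measurable g →
      ∫⁻ τ : ℝ, ENNReal.ofReal ((1 + τ ^ 2) ^ (-(a + 1 / 2))) * ‖gaussianAverage g τ‖ₑ ^ 2 ≤
        C * (∫⁻ y, ENNReal.ofReal ((1 + |y|) ^ (-(a * s))) * ‖g y‖ₑ ^ s) ^ (2 / s) := by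
  obtain ⟨C₁, hC₁, h₁⟩ := exists_norm_gaussianKernel_le ha
  obtain ⟨C₂, h₂⟩ := exists_lintegral_mul_mul_inv_one_add_le hs1 hs2
  refine ⟨(C₁ * 2 ^ a).toNNReal * C₂, fun g hg hgm => ?_⟩
  -- The factor `(1 + y² + y'²)^(-a)` splits into a product of powers in y and y', each of which is
  -- absorbed into its copy of g.
  have hY := h₂ (fun y => ENNReal.ofReal ((1 + |y|) ^ (-a)) * ‖g y‖ₑ) (by fun_prop)
  have e : ∀ y : ℝ, (ENNReal.ofReal ((1 + |y|) ^ (-a)) * ‖g y‖ₑ) ^ s =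
      ENNReal.ofReal ((1 + |y|) ^ (-(a * s))) * ‖g y‖ₑ ^ s := by
    intro y
    rw [ENNReal.mul_rpow_of_nonneg _ _ (by linarith),
      ENNReal.ofReal_rpow_of_nonneg (by positivity) (by linarith), ← Real.rpow_mul (by positivity),
      neg_mul]
  simp only [e] at hY
  refine (lintegral_gaussianAverage_le (by linarith) hg).trans ?_
  rw [ENNReal.coe_mul, mul_assoc]
  refine le_trans ?_ (mul_le_mul_right hY _)
  rw [← lintegral_const_mul _ (by fun_prop)]
  refine lintegral_mono fun p => ?_
  have hk : ‖gaussianKernel a p.1 p.2‖ₑ ≤ ENNReal.ofReal (C₁ * 2 ^ a) *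
      (ENNReal.ofReal ((1 + |p.1|) ^ (-a)) * ENNReal.ofReal ((1 + |p.2|) ^ (-a)) *
        ENNReal.ofReal ((1 + |(|p.1| - |p.2|)|)⁻¹)) := by
    rw [← ENNReal.ofReal_mul (by positivity), ← ENNReal.ofReal_mul (by positivity),
      ← ENNReal.ofReal_mul (by positivity), ← ofReal_norm]
    refine ENNReal.ofReal_le_ofReal ((h₁ p.1 p.2).trans ?_)
    rw [mul_assoc]
    refine mul_le_mul_of_nonneg_left ?_ hC₁.le
    rw [← mul_assoc]
    exact mul_le_mul_of_nonneg_right (one_add_sq_add_sq_rpow_neg_le (by linarith) _ _)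
      (by positivity)
  calc _ ≤ ‖g p.1‖ₑ * ‖g p.2‖ₑ * _ := mul_le_mul_right hk _
    _ = _ := by
      rw [show ((C₁ * 2 ^ a).toNNReal : ℝ≥0∞) = ENNReal.ofReal (C₁ * 2 ^ a) from rfl]
      ring

/-! ### Laplace inversion for the truncated power -/

/-- The Laplace transform of `v ^ β` at `1 + iτ`. -/
noncomputable def laplaceRpow (β τ : ℝ) : ℂ :=
  ∫ v in Set.Ioi (0 : ℝ), ((v ^ β : ℝ) : ℂ) * Complex.exp (-((1 + τ * Complex.I) * v))

lemma norm_exp_neg_one_add_mul_I_mul (τ v : ℝ) :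
    ‖Complex.exp (-((1 + τ * Complex.I) * v))‖ = Real.exp (-v) := by
  rw [Complex.norm_exp]
  simp

lemma integrableOn_rpow_mul_exp_neg {β : ℝ} (hβ : -1 < β) :
    IntegrableOn (fun v : ℝ => v ^ β * Real.exp (-v)) (Set.Ioi 0) := by
  have h := Real.GammaIntegral_convergent (show 0 < β + 1 by linarith)
  simp only [add_sub_cancel_right] at h
  exact h.congr_fun (fun v _ => mul_comm _ _) measurableSet_Ioi

lemma integrableOn_laplaceRpow {β : ℝ} (hβ : -1 < β) (τ : ℝ) :
    IntegrableOn (fun v : ℝ => ((v ^ β : ℝ) : ℂ) * Complex.exp (-((1 + τ * Complex.I) * v)))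
      (Set.Ioi 0) := by
  refine Integrable.mono' (integrableOn_rpow_mul_exp_neg hβ)
    (by fun_prop : Measurable _).aestronglyMeasurable ?_
  refine (ae_restrict_iff' measurableSet_Ioi).2 (ae_of_all _ fun v hv => ?_)
  rw [norm_mul, norm_exp_neg_one_add_mul_I_mul, Complex.norm_real,
    Real.norm_of_nonneg (Real.rpow_nonneg (le_of_lt hv) _)]

lemma hasDerivAt_laplaceRpow {β : ℝ} (hβ : -1 < β) (τ : ℝ) :
    HasDerivAt (laplaceRpow β) (-Complex.I * laplaceRpow (β + 1) τ) τ := by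
  have h := (hasDerivAt_integral_of_dominated_loc_of_deriv_le (𝕜 := ℝ)
    (μ := volume.restrict (Set.Ioi (0 : ℝ))) (s := Set.univ) (x₀ := τ)
    (bound := fun v => v ^ (β + 1) * Real.exp (-v))
    (F := fun (τ v : ℝ) => ((v ^ β : ℝ) : ℂ) * Complex.exp (-((1 + τ * Complex.I) * v)))
    (F' := fun (τ v : ℝ) => -Complex.I *
      (((v ^ (β + 1) : ℝ) : ℂ) * Complex.exp (-((1 + τ * Complex.I) * v)))) Filter.univ_mem
    (Filter.Eventually.of_forall fun τ => (by fun_prop : Measurable _).aestronglyMeasurable)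
    (integrableOn_laplaceRpow hβ τ) (by fun_prop : Measurable _).aestronglyMeasurable ?_
    (integrableOn_rpow_mul_exp_neg (by linarith)) ?_).2
  · rwa [integral_const_mul] at h
  · refine (ae_restrict_iff' measurableSet_Ioi).2 (ae_of_all _ fun v hv τ _ => ?_)
    rw [norm_mul, norm_mul, norm_exp_neg_one_add_mul_I_mul, Complex.norm_real, norm_neg,
      Complex.norm_I, one_mul, Real.norm_of_nonneg (Real.rpow_nonneg (le_of_lt hv) _)]
  · refine (ae_restrict_iff' measurableSet_Ioi).2 (ae_of_all _ fun v hv τ _ => ?_)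
    have h1 : HasDerivAt (fun t : ℝ => -((1 + (t : ℂ) * Complex.I) * v)) (-(Complex.I * v)) τ := by
      simpa using ((((Complex.ofRealCLM.hasDerivAt (x := τ)).mul_const Complex.I).const_add
        1).mul_const (v : ℂ)).fun_neg
    refine (h1.cexp.const_mul ((v ^ β : ℝ) : ℂ)).congr_deriv ?_
    rw [Real.rpow_add_one (ne_of_gt hv)]
    push_cast; ring

lemma one_add_mul_I_mul_laplaceRpow {β : ℝ} (hβ : 0 < β) (τ : ℝ) :
    (1 + τ * Complex.I) * laplaceRpow β τ = β * laplaceRpow (β - 1) τ := by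
  have hi1 := (integrableOn_laplaceRpow (show -1 < β - 1 by linarith) τ).const_mul (β : ℂ)
  have hi2 := (integrableOn_laplaceRpow (show -1 < β by linarith) τ).const_mul
    (1 + τ * Complex.I : ℂ)
  have hd : ∀ v ∈ Set.Ioi (0 : ℝ), HasDerivAt
      (fun v : ℝ => ((v ^ β : ℝ) : ℂ) * Complex.exp (-((1 + τ * Complex.I) * v)))
      (β * (((v ^ (β - 1) : ℝ) : ℂ) * Complex.exp (-((1 + τ * Complex.I) * v))) -
        (1 + τ * Complex.I) * (((v ^ β : ℝ) : ℂ) * Complex.exp (-((1 + τ * Complex.I) * v)))) v := by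
    intro v hv
    have h1 : HasDerivAt (fun v : ℝ => -((1 + τ * Complex.I) * (v : ℂ)))
        (-(1 + τ * Complex.I)) v := by
      simpa using ((Complex.ofRealCLM.hasDerivAt (x := v)).const_mul (1 + τ * Complex.I : ℂ)).fun_neg
    have h2 := (Real.hasDerivAt_rpow_const (x := v) (p := β) (Or.inl (ne_of_gt hv))).ofReal_comp
    refine (h2.mul h1.cexp).congr_deriv ?_
    push_cast; ring
  have hc : ContinuousWithinAt (fun v : ℝ => ((v ^ β : ℝ) : ℂ) *
      Complex.exp (-((1 + τ * Complex.I) * v))) (Set.Ici 0) 0 := by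
    refine Continuous.continuousWithinAt ?_
    have : Continuous fun v : ℝ => v ^ β := Real.continuous_rpow_const hβ.le
    fun_prop
  have ht : Filter.Tendsto (fun v : ℝ => ((v ^ β : ℝ) : ℂ) *
      Complex.exp (-((1 + τ * Complex.I) * v))) Filter.atTop (nhds 0) := by
    rw [tendsto_zero_iff_norm_tendsto_zero]
    have h := tendsto_rpow_mul_exp_neg_mul_atTop_nhds_zero β 1 one_pos
    refine h.congr' ?_
    filter_upwards [Filter.eventually_gt_atTop 0] with v hv
    rw [norm_mul, norm_exp_neg_one_add_mul_I_mul, Complex.norm_real,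
      Real.norm_of_nonneg (Real.rpow_nonneg hv.le _)]
    simp
  have h := integral_Ioi_of_hasDerivAt_of_tendsto hc hd (hi1.sub hi2) ht
  rw [integral_sub hi1 hi2, integral_const_mul, integral_const_mul, Real.zero_rpow hβ.ne'] at h
  unfold laplaceRpow
  simp only [Complex.ofReal_zero, zero_mul, sub_zero] at h
  linear_combination -h

lemma one_add_mul_I_mem_slitPlane (τ : ℝ) : (1 + τ * Complex.I : ℂ) ∈ Complex.slitPlane :=
  Or.inl (by simp)

/-- An ODE argument: differentiation under the integral together with integration by parts shows
that the transform times `(1 + iτ)^(β+1)` has zero derivative in τ, and its value at 0 is the Gamma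
integral. -/
lemma laplaceRpow_eq {β : ℝ} (hβ : -1 < β) (τ : ℝ) :
    laplaceRpow β τ = Real.Gamma (β + 1) * (1 + τ * Complex.I) ^ (((-(β + 1) : ℝ)) : ℂ) := by
  have hid : ∀ τ : ℝ, HasDerivAt (fun t : ℝ => (1 + (t : ℂ) * Complex.I)) Complex.I τ := fun τ => by
    simpa using ((Complex.ofRealCLM.hasDerivAt (x := τ)).mul_const Complex.I).const_add 1
  have hd : ∀ τ, HasDerivAt (fun τ : ℝ => laplaceRpow β τ *
      (1 + τ * Complex.I) ^ (((β + 1 : ℝ)) : ℂ)) 0 τ := by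
    intro τ
    have hp : HasDerivAt (fun t : ℝ => (1 + (t : ℂ) * Complex.I) ^ (((β + 1 : ℝ)) : ℂ))
        (((β + 1 : ℝ) : ℂ) * (1 + τ * Complex.I) ^ (((β + 1 : ℝ) : ℂ) - 1) * Complex.I) τ :=
      HasDerivAt.comp (h₂ := fun z : ℂ => z ^ (((β + 1 : ℝ)) : ℂ)) τ
        (Complex.hasStrictDerivAt_cpow_const (one_add_mul_I_mem_slitPlane τ)).hasDerivAt (hid τ)
    refine ((hasDerivAt_laplaceRpow hβ τ).mul hp).congr_deriv ?_
    have h1 := one_add_mul_I_mul_laplaceRpow (show 0 < β + 1 by linarith) τ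
    rw [add_sub_cancel_right] at h1
    rw [Complex.cpow_sub _ _ (one_add_mul_I_ne_zero τ), Complex.cpow_one]
    have h2 : laplaceRpow (β + 1) τ =
        ((β + 1 : ℝ) : ℂ) * laplaceRpow β τ / (1 + τ * Complex.I) := by
      rw [← h1, mul_div_cancel_left₀ _ (one_add_mul_I_ne_zero τ)]
    rw [h2]; ring
  have hconst := is_const_of_deriv_eq_zero (fun τ => (hd τ).differentiableAt)
    (fun τ => (hd τ).deriv) τ 0
  have h0 : laplaceRpow β 0 = Real.Gamma (β + 1) := by
    rw [Real.Gamma_eq_integral (by linarith), laplaceRpow, ← integral_complex_ofReal]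
    congr 1; ext v
    push_cast
    rw [add_sub_cancel_right]
    simp [mul_comm]
  simp only [Complex.ofReal_zero, zero_mul, add_zero, Complex.one_cpow, mul_one, h0] at hconst
  rw [← hconst, mul_assoc, ← Complex.cpow_add _ _ (one_add_mul_I_ne_zero τ)]
  simp

lemma norm_one_add_mul_I (τ : ℝ) : ‖(1 + τ * Complex.I : ℂ)‖ = (1 + τ ^ 2) ^ (1 / 2 : ℝ) := by
  have := Complex.norm_add_mul_I 1 τ
  rw [Complex.ofReal_one, one_pow] at this
  rw [this, Real.sqrt_eq_rpow]

lemma norm_one_add_mul_I_cpow (τ b : ℝ) :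
    ‖(1 + τ * Complex.I : ℂ) ^ (b : ℂ)‖ = (1 + τ ^ 2) ^ (b / 2) := by
  rw [Complex.norm_cpow_real, norm_one_add_mul_I, ← Real.rpow_mul (by positivity)]
  congr 1; ring

/-- The inverse Laplace transform formula for the truncated power `v₊ ^ α`. -/
lemma ofReal_max_rpow_eq_integral {α : ℝ} (hα : 0 < α) (v : ℝ) :
    (((max v 0) ^ α : ℝ) : ℂ) = (Real.Gamma (α + 1) / (2 * Real.pi) : ℝ) *
      ∫ τ : ℝ, (1 + τ * Complex.I) ^ (((-(α + 1) : ℝ)) : ℂ) *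
        Complex.exp ((1 + τ * Complex.I) * v) := by
  -- Damping by `e^{-v}` makes Fourier inversion applicable. Positivity of α gives both continuity
  -- of ψ and integrability of its transform, so inversion holds at every point.
  set ψ : ℝ → ℂ := fun v => (((max v 0) ^ α : ℝ) : ℂ) * Complex.exp (-v) with hψ
  have hψc : Continuous ψ := by
    have : Continuous fun v : ℝ => (max v 0) ^ α :=
      (Real.continuous_rpow_const hα.le).comp (by fun_prop)
    fun_prop
  have hψi : ψ = (Set.Ioi (0 : ℝ)).indicator
      (fun v => ((v ^ α : ℝ) : ℂ) * Complex.exp (-((1 + (0 : ℝ) * Complex.I) * v))) := by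
    ext v
    by_cases hv : 0 < v
    · rw [Set.indicator_of_mem (by exact hv), hψ]
      simp [max_eq_left hv.le]
    · rw [Set.indicator_of_notMem (by exact hv), hψ]
      simp [max_eq_right (not_lt.1 hv), Real.zero_rpow hα.ne']
  have hψI : Integrable ψ := by
    rw [hψi]
    exact (integrableOn_laplaceRpow (by linarith) 0).integrable_indicator measurableSet_Ioi
  have hF : ∀ t, 𝓕 ψ t = Real.Gamma (α + 1) *
      (1 + ((2 * Real.pi * t : ℝ) : ℂ) * Complex.I) ^ (((-(α + 1) : ℝ)) : ℂ) := by
    intro t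
    rw [← laplaceRpow_eq (by linarith), Real.fourier_real_eq_integral_exp_smul, laplaceRpow,
      ← integral_indicator measurableSet_Ioi]
    congr 1; ext v
    rw [hψi]
    by_cases hv : 0 < v
    · rw [Set.indicator_of_mem (by exact hv), Set.indicator_of_mem (by exact hv), smul_eq_mul,
        mul_left_comm, ← Complex.exp_add]
      congr 2
      push_cast; ring
    · rw [Set.indicator_of_notMem (by exact hv), Set.indicator_of_notMem (by exact hv), smul_zero]
  have hw : Integrable fun τ : ℝ => (1 + (τ : ℂ) * Complex.I) ^ (((-(α + 1) : ℝ)) : ℂ) := by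
    refine (integrable_one_add_sq_rpow (b := (α + 1) / 2) (by linarith)).mono'
      (by fun_prop : Measurable _).aestronglyMeasurable (ae_of_all _ fun τ => ?_)
    rw [norm_one_add_mul_I_cpow, neg_div]
  have hFI : Integrable (𝓕 ψ) := by
    have h2 := (hw.comp_mul_left' (by positivity : 2 * Real.pi ≠ 0)).const_mul
      (Real.Gamma (α + 1) : ℂ)
    exact h2.congr (ae_of_all _ fun t => (hF t).symm)
  have hinv := congrFun (hψc.fourierInv_fourier_eq hψI hFI) v
  rw [Real.fourierInv_eq_fourier_neg, Real.fourier_real_eq_integral_exp_smul] at hinv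
  simp only [hF] at hinv
  have hsub := Measure.integral_comp_mul_left (fun τ : ℝ =>
    (1 + (τ : ℂ) * Complex.I) ^ (((-(α + 1) : ℝ)) : ℂ) *
      Complex.exp ((1 + (τ : ℂ) * Complex.I) * v)) (2 * Real.pi)
  have hval : (((max v 0) ^ α : ℝ) : ℂ) = ψ v * Complex.exp v := by
    rw [hψ]
    simp only
    rw [mul_assoc, ← Complex.exp_add]; simp
  rw [abs_of_pos (by positivity), Complex.real_smul] at hsub
  rw [hval, ← hinv, div_eq_mul_inv, Complex.ofReal_mul, mul_assoc, ← hsub, ← integral_mul_const,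
    ← integral_const_mul]
  congr 1; ext t
  rw [smul_eq_mul]
  have e : Complex.exp ((1 + ((2 * Real.pi * t : ℝ) : ℂ) * Complex.I) * v) =
      Complex.exp (((-2 * Real.pi * t * -v : ℝ) : ℂ) * Complex.I) * Complex.exp v := by
    rw [← Complex.exp_add]; congr 1; push_cast; ring
  rw [e]; ring

/-! ### Separation of variables and bounds for the damped evolution -/

/-- The damped Schrödinger evolution of `f` at the point `x`. -/
noncomputable def dampedEvolution (R x : ℝ) (f : 𝓢(ℝ, ℂ)) (τ : ℝ) : ℂ :=
  ∫ ξ : ℝ, Complex.exp (-((1 + τ * Complex.I) * ((ξ ^ 2 / R ^ 2 : ℝ) : ℂ))) *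
    (𝓕 (f : ℝ → ℂ) ξ * Complex.exp (2 * Real.pi * Complex.I * (x * ξ : ℝ)))

lemma norm_exp_neg_one_add_mul_I_le_one (τ : ℝ) {u : ℝ} (hu : 0 ≤ u) :
    ‖Complex.exp (-((1 + τ * Complex.I) * (u : ℂ)))‖ ≤ 1 := by
  rw [norm_exp_neg_one_add_mul_I_mul]
  simpa using hu

lemma norm_exp_two_pi_I_mul (u : ℝ) : ‖Complex.exp (2 * Real.pi * Complex.I * (u : ℂ))‖ = 1 := by
  rw [show 2 * Real.pi * Complex.I * (u : ℂ) = ((2 * Real.pi * u : ℝ) : ℂ) * Complex.I by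
    push_cast; ring, Complex.norm_exp_ofReal_mul_I]

lemma SchwartzMap.integrable_fourier (f : 𝓢(ℝ, ℂ)) : Integrable (𝓕 (f : ℝ → ℂ)) := by
  rw [← SchwartzMap.fourier_coe]; exact SchwartzMap.integrable _

lemma SchwartzMap.continuous_fourier (f : 𝓢(ℝ, ℂ)) : Continuous (𝓕 (f : ℝ → ℂ)) := by
  rw [← SchwartzMap.fourier_coe]; exact SchwartzMap.continuous _

lemma integrable_cpow_mul_exp {α : ℝ} (hα : 0 < α) :
    Integrable fun τ : ℝ => (1 + (τ : ℂ) * Complex.I) ^ (((-(α + 1) : ℝ)) : ℂ) *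
      Complex.exp (1 + τ * Complex.I) := by
  refine ((integrable_one_add_sq_rpow (b := (α + 1) / 2) (by linarith)).mul_const
    (Real.exp 1)).mono' (by fun_prop : Measurable _).aestronglyMeasurable (ae_of_all _ fun τ => ?_)
  rw [norm_mul, norm_one_add_mul_I_cpow, neg_div, Complex.norm_exp]
  simp

/-- With `v = 1 - |ξ|²/R²` in the inversion formula, the exponential factors over coordinates. The
weight is integrable in τ and the Fourier transforms are integrable in ξ, so Fubini applies and the
ξ-integral becomes a product. -/
lemma bochnerRieszMean_eq_integral {m : ℕ} {α R : ℝ} (hα : 0 < α) (f : Fin m → 𝓢(ℝ, ℂ)) (x : ℝ) :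
    bochnerRieszMean α R f x = (Real.Gamma (α + 1) / (2 * Real.pi) : ℝ) *
      ∫ τ : ℝ, (1 + (τ : ℂ) * Complex.I) ^ (((-(α + 1) : ℝ)) : ℂ) *
        Complex.exp (1 + τ * Complex.I) * ∏ i, dampedEvolution R x (f i) τ := by
  set c : ℂ := ((Real.Gamma (α + 1) / (2 * Real.pi) : ℝ) : ℂ) with hc
  set w : ℝ → ℂ := fun τ => (1 + (τ : ℂ) * Complex.I) ^ (((-(α + 1) : ℝ)) : ℂ) *
        Complex.exp (1 + τ * Complex.I) with hw
  set φ : Fin m → ℝ → ℂ := fun i ξ =>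
    𝓕 (f i : ℝ → ℂ) ξ * Complex.exp (2 * Real.pi * Complex.I * (x * ξ : ℝ)) with hφ
  set γ : ℝ → ℝ → ℂ := fun τ ξ =>
    Complex.exp (-((1 + τ * Complex.I) * ((ξ ^ 2 / R ^ 2 : ℝ) : ℂ))) with hγ
  have hγ1 : ∀ τ ξ, ‖γ τ ξ‖ ≤ 1 := fun τ ξ =>
    norm_exp_neg_one_add_mul_I_le_one τ (by positivity)
  have hφi : ∀ i, Integrable (φ i) := fun i =>
    (f i).integrable_fourier.mul_bdd (c := 1)
      (by fun_prop : Measurable _).aestronglyMeasurable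
      (ae_of_all _ fun ξ => (norm_exp_two_pi_I_mul _).le)
  have hφm : ∀ i, Measurable (φ i) := fun i => by
    have := (f i).continuous_fourier.measurable
    fun_prop
  have hpt : ∀ ξ : Fin m → ℝ, (bochnerRieszMultiplier α R ξ : ℂ) *
      (∏ i, 𝓕 (f i : ℝ → ℂ) (ξ i)) *
      Complex.exp (2 * Real.pi * Complex.I * (x * ∑ i, ξ i : ℝ)) =
      c * ∫ τ : ℝ, w τ * ∏ i, (γ τ (ξ i) * φ i (ξ i)) := by
    intro ξ
    have hexp : Complex.exp (2 * Real.pi * Complex.I * (x * ∑ i, ξ i : ℝ)) =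
        ∏ i, Complex.exp (2 * Real.pi * Complex.I * (x * ξ i : ℝ)) := by
      rw [← Complex.exp_sum, ← Finset.mul_sum, ← Complex.ofReal_sum, ← Finset.mul_sum]
    have hφp : ∏ i, φ i (ξ i) = (∏ i, 𝓕 (f i : ℝ → ℂ) (ξ i)) *
        Complex.exp (2 * Real.pi * Complex.I * (x * ∑ i, ξ i : ℝ)) := by
      rw [hexp, ← Finset.prod_mul_distrib]
    rw [mul_assoc, ← hφp, bochnerRieszMultiplier, ofReal_max_rpow_eq_integral hα, mul_assoc,
      ← integral_mul_const]
    congr 2; ext τ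
    have he : Complex.exp ((1 + τ * Complex.I) * ((1 - (∑ i, ξ i ^ 2) / R ^ 2 : ℝ) : ℂ)) =
        Complex.exp (1 + τ * Complex.I) * ∏ i, γ τ (ξ i) := by
      rw [hγ]
      simp only
      rw [← Complex.exp_sum, ← Complex.exp_add]
      congr 1
      rw [Finset.sum_neg_distrib, ← Finset.mul_sum, ← Complex.ofReal_sum, ← Finset.sum_div]
      push_cast; ring
    have hd : ∏ i, (γ τ (ξ i) * φ i (ξ i)) = (∏ i, γ τ (ξ i)) * ∏ i, φ i (ξ i) :=
      Finset.prod_mul_distrib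
    rw [hd, he, hw]
    ring
  have hprod : Integrable (fun ξ : Fin m → ℝ => ∏ i, φ i (ξ i)) := Integrable.fintype_prod hφi
  have hjoint := (integrable_cpow_mul_exp hα).mul_prod hprod
  have hint : Integrable (fun q : ℝ × (Fin m → ℝ) => w q.1 * ∏ i, (γ q.1 (q.2 i) * φ i (q.2 i)))
      ((volume : Measure ℝ).prod volume) := by
    have hm : Measurable fun q : ℝ × (Fin m → ℝ) => ∏ i, γ q.1 (q.2 i) := by
      rw [hγ]
      refine Finset.measurable_fun_prod _ fun i _ => ?_
      fun_prop
    refine (hjoint.mul_bdd (c := 1) hm.aestronglyMeasurable (ae_of_all _ fun q => ?_)).congr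
      (ae_of_all _ fun q => ?_)
    · rw [norm_prod]
      exact Finset.prod_le_one (fun i _ => norm_nonneg _) fun i _ => hγ1 _ _
    · simp only [Finset.prod_mul_distrib]; ring
  rw [bochnerRieszMean]
  simp only [hpt]
  rw [integral_const_mul, ← integral_integral_swap
    (f := fun (τ : ℝ) (ξ : Fin m → ℝ) => w τ * ∏ i, (γ τ (ξ i) * φ i (ξ i))) hint]
  congr 2; ext τ
  rw [integral_const_mul, integral_fintype_prod_volume_eq_prod (fun i ξ => γ τ ξ * φ i ξ)]
  rfl

lemma integral_fourier_mul_eq_integral_mul_fourier {f g : ℝ → ℂ} (hf : Integrable f)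
    (hg : Integrable g) : ∫ ξ, 𝓕 f ξ * g ξ = ∫ y, f y * 𝓕 g y := by
  have h := VectorFourier.integral_fourierIntegral_smul_eq_flip (L := innerₗ ℝ) (μ := volume)
    (ν := volume) Real.continuous_fourierChar continuous_inner hf hg
  simpa using! h

/-- The Fourier transform moves from f onto the complex Gaussian, and the substitution `v = πR(x -
y)` normalises the width. The factor R from the Gaussian cancels the Jacobian, so later bounds are
uniform in R and survive the supremum. -/
lemma norm_dampedEvolution_le {R : ℝ} (hR : 0 < R) (x : ℝ) (f : 𝓢(ℝ, ℂ)) (τ : ℝ) :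
    ‖dampedEvolution R x f τ‖ ≤ (1 + τ ^ 2) ^ (-(1 / 4 : ℝ)) *
      ‖gaussianAverage (fun v => f (x - v / (Real.pi * R))) τ‖ := by
  have hpi := Real.pi_pos
  have hz := one_add_mul_I_ne_zero τ
  set z : ℂ := 1 + τ * Complex.I with hzdef
  set b : ℂ := z / (R : ℂ) ^ 2 with hb
  have hRc : (R : ℂ) ≠ 0 := by exact_mod_cast hR.ne'
  have hpic : (Real.pi : ℂ) ≠ 0 := by exact_mod_cast hpi.ne'
  have hbre : 0 < b.re := by
    rw [hb, ← Complex.ofReal_pow, Complex.div_ofReal_re, hzdef]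
    simp; positivity
  set G : ℝ → ℂ := fun ξ => Complex.exp (-b * (ξ : ℂ) ^ 2) *
    Complex.exp (2 * Real.pi * Complex.I * (x * ξ : ℝ)) with hG
  have hGi : Integrable G :=
    (integrable_cexp_neg_mul_sq hbre).mul_bdd (c := 1)
      (by fun_prop : Measurable _).aestronglyMeasurable
      (ae_of_all _ fun ξ => (norm_exp_two_pi_I_mul _).le)
  have hFG : ∀ y, 𝓕 G y = (Real.pi / b) ^ (1 / 2 : ℂ) *
      Complex.exp (-(((Real.pi * R * (x - y) : ℝ) : ℂ) ^ 2 / z)) := by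
    intro y
    have h := fourierIntegral_gaussian hbre (((2 * Real.pi * (x - y) : ℝ)) : ℂ)
    rw [Real.fourier_real_eq_integral_exp_smul]
    have e : -((2 * Real.pi * (x - y) : ℝ) : ℂ) ^ 2 / (4 * b) =
        -(((Real.pi * R * (x - y) : ℝ) : ℂ) ^ 2 / z) := by
      rw [hb]; push_cast; field_simp; ring
    rw [← e, ← h]
    congr 1; ext ξ
    rw [hG, smul_eq_mul]
    simp only
    rw [mul_comm (Complex.exp (-b * _)), ← mul_assoc, ← Complex.exp_add]
    congr 2
    push_cast; ring
  have h1 : dampedEvolution R x f τ = ∫ y, f y * 𝓕 G y := by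
    rw [← integral_fourier_mul_eq_integral_mul_fourier f.integrable hGi, dampedEvolution]
    congr 1; ext ξ
    rw [hG]
    simp only
    rw [mul_left_comm]
    congr 3
    rw [hb, hzdef]; push_cast; ring
  set K : ℝ → ℂ := fun y => f y * Complex.exp (-(((Real.pi * R * (x - y) : ℝ) : ℂ) ^ 2 / z)) with hK
  have h2 : ∫ y, f y * 𝓕 G y = (Real.pi / b) ^ (1 / 2 : ℂ) * ∫ y, K y := by
    rw [← integral_const_mul]
    congr 1; ext y
    rw [hFG, hK]; ring
  have h3 : gaussianAverage (fun v => f (x - v / (Real.pi * R))) τ =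
      ((Real.pi * R : ℝ) : ℂ) * ∫ y, K y := by
    have hs := Measure.integral_comp_div (fun v => K (x - v)) (Real.pi * R)
    rw [integral_sub_left_eq_self K volume x, abs_of_pos (by positivity), Complex.real_smul] at hs
    rw [← hs, gaussianAverage]
    congr 1; ext v
    rw [hK]
    simp only
    congr 3
    rw [sub_sub_cancel, mul_div_cancel₀ _ (by positivity)]
  have hnorm : ‖((Real.pi : ℂ) / b) ^ (1 / 2 : ℂ)‖ =
      (1 + τ ^ 2) ^ (-(1 / 4 : ℝ)) * (√Real.pi * R) := by
    have hcast : (1 / 2 : ℂ) = ((1 / 2 : ℝ) : ℂ) := by norm_num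
    rw [hcast, Complex.norm_cpow_real, hb, norm_div, norm_div, norm_pow, Complex.norm_real,
      Complex.norm_real, Real.norm_of_nonneg hpi.le, Real.norm_of_nonneg hR.le,
      norm_one_add_mul_I, div_div_eq_mul_div, Real.div_rpow (by positivity) (by positivity),
      Real.mul_rpow (by positivity) (by positivity), ← Real.sqrt_eq_rpow, ← Real.sqrt_eq_rpow,
      Real.sqrt_sq hR.le, ← Real.rpow_mul (by positivity), Real.rpow_neg (by positivity),
      div_eq_inv_mul]
    norm_num
  rw [h1, h2, h3, norm_mul, norm_mul, hnorm, Complex.norm_real, Real.norm_of_nonneg (by positivity),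
    mul_assoc]
  have hle : √Real.pi ≤ Real.pi := by
    rw [Real.sqrt_le_left hpi.le]; nlinarith [Real.pi_gt_three]
  gcongr

/-- With `u = |y| / √(1 + τ²)` the modulus is `e^{-u²}`, and `e^{u²} ≥ 1 + u² ≥ (1 + u)²/2`. The
exponent 2 exceeds 1, so the maximal function controls the average. -/
lemma norm_exp_neg_sq_div_le (y τ : ℝ) :
    ‖Complex.exp (-((y : ℂ) ^ 2 / (1 + τ * Complex.I)))‖ ≤
      2 * (1 + |y| / (1 + τ ^ 2) ^ (1 / 2 : ℝ)) ^ (-2 : ℝ) := by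
  have h := norm_exp_neg_gaussianPhase y 0 τ
  rw [gaussianPhase] at h
  simp only [Complex.ofReal_zero, ne_eq, OfNat.ofNat_ne_zero, not_false_eq_true, zero_pow,
    zero_div, add_zero] at h
  rw [h]
  set l := (1 + τ ^ 2) ^ (1 / 2 : ℝ) with hl
  have hl2 : l ^ 2 = 1 + τ ^ 2 := by
    rw [hl, ← Real.sqrt_eq_rpow, Real.sq_sqrt (by positivity)]
  have hl0 : 0 < l := by positivity
  set u := |y| / l with hu
  have hu0 : 0 ≤ u := by positivity
  have hu2 : y ^ 2 / (1 + τ ^ 2) = u ^ 2 := by rw [hu, div_pow, sq_abs, hl2]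
  rw [hu2, Real.rpow_neg (by positivity), Real.rpow_ofNat, ← div_eq_mul_inv, Real.exp_neg,
    inv_eq_one_div, div_le_div_iff₀ (Real.exp_pos _) (by positivity)]
  have := Real.add_one_le_exp (u ^ 2)
  nlinarith [sq_nonneg (u - 1)]

lemma exists_enorm_dampedEvolution_le : ∃ C : ℝ≥0, ∀ (f : 𝓢(ℝ, ℂ)) (R x τ : ℝ), 0 < R →
    ‖dampedEvolution R x f τ‖ₑ ≤
      C * ENNReal.ofReal ((1 + τ ^ 2) ^ (1 / 4 : ℝ)) * dyadicMaximal (fun y => ‖f y‖ₑ) x := by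
  obtain ⟨C, hC⟩ := lintegral_one_add_abs_rpow_mul_le_dyadicMaximal (b := 2) (by norm_num)
  refine ⟨2 * C, fun f R x τ hR => ?_⟩
  have hfm : Measurable fun y => ‖f y‖ₑ := f.continuous.measurable.enorm
  have h := hC (fun y => ‖f y‖ₑ) hfm x (Real.pi * R) (by positivity)
    ((1 + τ ^ 2) ^ (1 / 2 : ℝ)) (by positivity)
  have hg : ‖gaussianAverage (fun v => f (x - v / (Real.pi * R))) τ‖ₑ ≤
      2 * (C * ENNReal.ofReal ((1 + τ ^ 2) ^ (1 / 2 : ℝ)) *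
        dyadicMaximal (fun y => ‖f y‖ₑ) x) := by
    refine (enorm_integral_le_lintegral_enorm _).trans (le_trans ?_ (mul_le_mul_right h 2))
    rw [← lintegral_const_mul' _ _ (by norm_num)]
    refine lintegral_mono fun v => ?_
    rw [enorm_mul, mul_comm, ← mul_assoc]
    refine mul_le_mul_left ?_ _
    rw [← ofReal_norm, ← ENNReal.ofReal_ofNat 2, ← ENNReal.ofReal_mul (by norm_num)]
    exact ENNReal.ofReal_le_ofReal (norm_exp_neg_sq_div_le v τ)
  calc ‖dampedEvolution R x f τ‖ₑ ≤ ENNReal.ofReal ((1 + τ ^ 2) ^ (-(1 / 4 : ℝ))) *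
        ‖gaussianAverage (fun v => f (x - v / (Real.pi * R))) τ‖ₑ := by
        rw [← ofReal_norm, ← ofReal_norm, ← ENNReal.ofReal_mul (by positivity)]
        exact ENNReal.ofReal_le_ofReal (norm_dampedEvolution_le hR x f τ)
    _ ≤ _ := mul_le_mul_right hg _
    _ = 2 * C * (ENNReal.ofReal ((1 + τ ^ 2) ^ (-(1 / 4 : ℝ))) *
        ENNReal.ofReal ((1 + τ ^ 2) ^ (1 / 2 : ℝ))) * dyadicMaximal (fun y => ‖f y‖ₑ) x := by ring
    _ = _ := by
        rw [← ENNReal.ofReal_mul (by positivity), ← Real.rpow_add (by positivity)]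
        norm_num

/-- The square function estimate for the damped evolution. -/
lemma exists_lintegral_dampedEvolution_sq_le {s a : ℝ} (hs1 : 1 < s) (hs2 : s < 2)
    (ha : 1 < a * s) : ∃ C : ℝ≥0, ∀ (f : 𝓢(ℝ, ℂ)) (R x : ℝ), 0 < R →
      (∫⁻ τ : ℝ, (ENNReal.ofReal ((1 + τ ^ 2) ^ (-(a / 2))) * ‖dampedEvolution R x f τ‖ₑ) ^
        (2 : ℝ)) ^ (1 / 2 : ℝ) ≤ C * dyadicMaximal (fun y => ‖f y‖ₑ ^ s) x ^ (1 / s) := by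
  have hs0 : 0 < s := by linarith
  have ha2 : 1 / 2 < a := by
    by_contra hcon
    have : a * s ≤ 1 / 2 * s := mul_le_mul_of_nonneg_right (not_lt.1 hcon) hs0.le
    linarith
  obtain ⟨C₁, h₁⟩ := exists_lintegral_gaussianAverage_sq_le hs1 hs2 ha2
  obtain ⟨C₂, h₂⟩ := lintegral_one_add_abs_rpow_mul_le_dyadicMaximal ha
  have hCt : ((C₁ : ℝ≥0∞) * (C₂ : ℝ≥0∞) ^ (2 / s)) ^ (1 / 2 : ℝ) ≠ ∞ := by
    refine ENNReal.rpow_ne_top_of_nonneg (by norm_num) (ENNReal.mul_ne_top ENNReal.coe_ne_top ?_)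
    exact ENNReal.rpow_ne_top_of_nonneg (by positivity) ENNReal.coe_ne_top
  refine ⟨(((C₁ : ℝ≥0∞) * (C₂ : ℝ≥0∞) ^ (2 / s)) ^ (1 / 2 : ℝ)).toNNReal, fun f R x hR => ?_⟩
  rw [ENNReal.coe_toNNReal hCt]
  have hfm : Measurable fun y => ‖f y‖ₑ ^ s := f.continuous.measurable.enorm.pow_const s
  have hρ : 0 < Real.pi * R := by positivity
  set g : ℝ → ℂ := fun v => f (x - v / (Real.pi * R)) with hg
  have hgi : Integrable g := by
    have h := ((f.integrable (μ := volume)).comp_sub_left x).comp_div hρ.ne'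
    exact h
  have hgm : Measurable g := by
    have := f.continuous.measurable
    fun_prop
  -- The weight `(1 + |v|)^(-as)` from the mean-square bound is an averaging weight exactly because
  -- `a s > 1`.
  have hM := h₂ (fun y => ‖f y‖ₑ ^ s) hfm x (Real.pi * R) hρ 1 one_pos
  simp only [div_one, ENNReal.ofReal_one, mul_one] at hM
  have hle : ∫⁻ τ : ℝ, (ENNReal.ofReal ((1 + τ ^ 2) ^ (-(a / 2))) *
      ‖dampedEvolution R x f τ‖ₑ) ^ (2 : ℝ) ≤
      ∫⁻ τ : ℝ, ENNReal.ofReal ((1 + τ ^ 2) ^ (-(a + 1 / 2))) * ‖gaussianAverage g τ‖ₑ ^ 2 := by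
    refine lintegral_mono fun τ => ?_
    rw [ENNReal.rpow_ofNat, ← ofReal_norm, ← ofReal_norm, ← ENNReal.ofReal_mul (by positivity),
      ← ENNReal.ofReal_pow (by positivity), ← ENNReal.ofReal_pow (by positivity),
      ← ENNReal.ofReal_mul (by positivity)]
    refine ENNReal.ofReal_le_ofReal ?_
    calc _ ≤ ((1 + τ ^ 2) ^ (-(a / 2)) *
          ((1 + τ ^ 2) ^ (-(1 / 4 : ℝ)) * ‖gaussianAverage g τ‖)) ^ 2 := by
          gcongr
          exact norm_dampedEvolution_le hR x f τ
      _ = _ := by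
          rw [← mul_assoc, ← Real.rpow_add (by positivity), mul_pow, ← Real.rpow_natCast,
            ← Real.rpow_mul (by positivity)]
          congr 2
          push_cast; ring
  calc _ ≤ ((C₁ : ℝ≥0∞) * (C₂ * dyadicMaximal (fun y => ‖f y‖ₑ ^ s) x) ^ (2 / s)) ^
        (1 / 2 : ℝ) := by
        refine ENNReal.rpow_le_rpow (hle.trans ((h₁ g hgi hgm).trans (mul_le_mul_right ?_ _)))
          (by norm_num)
        exact ENNReal.rpow_le_rpow hM (by positivity)
    _ = _ := by
        rw [ENNReal.mul_rpow_of_nonneg _ _ (by positivity : 0 ≤ 2 / s), ← mul_assoc,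
          ENNReal.mul_rpow_of_nonneg _ (_ ^ (2 / s)) (by norm_num : (0 : ℝ) ≤ 1 / 2),
          ← ENNReal.rpow_mul]
        congr 2
        ring

lemma measurable_dampedEvolution (R x : ℝ) (f : 𝓢(ℝ, ℂ)) : Measurable (dampedEvolution R x f) := by
  refine StronglyMeasurable.measurable ?_
  refine StronglyMeasurable.integral_prod_right (f := fun τ ξ : ℝ =>
    Complex.exp (-((1 + τ * Complex.I) * ((ξ ^ 2 / R ^ 2 : ℝ) : ℂ))) *
    (𝓕 (f : ℝ → ℂ) ξ * Complex.exp (2 * Real.pi * Complex.I * (x * ξ : ℝ)))) ?_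
  have := f.continuous_fourier.measurable
  refine Measurable.stronglyMeasurable ?_
  unfold Function.uncurry
  fun_prop

/-! ### Pointwise domination by maximal functions -/

/-- Pointwise domination of the maximal Bochner–Riesz operator by a product of maximal functions. -/
lemma exists_maximalBochnerRiesz_le {m : ℕ} {α : ℝ} (hα : 0 < α) {i₀ i₁ : Fin m} (hi : i₀ ≠ i₁)
    {s : Fin m → ℝ} {a₀ a₁ : ℝ} (hs₀ : 1 < s i₀ ∧ s i₀ < 2 ∧ 1 < a₀ * s i₀)
    (hs₁ : 1 < s i₁ ∧ s i₁ < 2 ∧ 1 < a₁ * s i₁) (hs : ∀ i, i ≠ i₀ → i ≠ i₁ → s i = 1)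
    (ha : a₀ + a₁ = α + 2 - m / 2) :
    ∃ C : ℝ≥0, ∀ (f : Fin m → 𝓢(ℝ, ℂ)) (x : ℝ), maximalBochnerRiesz α f x ≤
      C * ∏ i, dyadicMaximal (fun y => ‖f i y‖ₑ ^ s i) x ^ (1 / s i) := by
  obtain ⟨C, hC⟩ := exists_enorm_dampedEvolution_le
  obtain ⟨C₀, hC₀⟩ := exists_lintegral_dampedEvolution_sq_le hs₀.1 hs₀.2.1 hs₀.2.2
  obtain ⟨C₁, hC₁⟩ := exists_lintegral_dampedEvolution_sq_le hs₁.1 hs₁.2.1 hs₁.2.2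
  set c : ℝ := Real.Gamma (α + 1) / (2 * Real.pi) with hc
  have hc0 : 0 ≤ c := div_nonneg (Real.Gamma_pos_of_pos (by linarith)).le (by positivity)
  set T : Finset (Fin m) := (Finset.univ.erase i₀).erase i₁ with hT
  have hsplit : ∀ F : Fin m → ℝ≥0∞, ∏ i, F i = F i₀ * (F i₁ * ∏ i ∈ T, F i) := by
    intro F
    rw [hT, Finset.mul_prod_erase _ _ (Finset.mem_erase.2 ⟨hi.symm, Finset.mem_univ _⟩),
      Finset.mul_prod_erase _ _ (Finset.mem_univ _)]
  have hTs : ∀ i ∈ T, s i = 1 := fun i hiT => by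
    rw [hT, Finset.mem_erase, Finset.mem_erase] at hiT
    exact hs i hiT.2.1 hiT.1
  have hm2 : 2 ≤ m := by
    by_contra hcon
    have := Fin.isLt i₀; have := Fin.isLt i₁
    exact hi (Fin.ext (by omega))
  have hTcard : (T.card : ℝ) = m - 2 := by
    rw [hT, Finset.card_erase_of_mem (Finset.mem_erase.2 ⟨hi.symm, Finset.mem_univ _⟩),
      Finset.card_erase_of_mem (Finset.mem_univ _), Finset.card_univ, Fintype.card_fin,
      Nat.sub_sub, Nat.cast_sub hm2]
    norm_num
  refine ⟨(c * Real.exp 1).toNNReal * (C ^ T.card * (C₀ * C₁)), fun f x => ?_⟩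
  refine iSup_le fun R => iSup_le fun hR => ?_
  set G : Fin m → ℝ≥0∞ := fun i => dyadicMaximal (fun y => ‖f i y‖ₑ ^ s i) x ^ (1 / s i) with hG
  set U₀ : ℝ → ℝ≥0∞ := fun τ =>
    ENNReal.ofReal ((1 + τ ^ 2) ^ (-(a₀ / 2))) * ‖dampedEvolution R x (f i₀) τ‖ₑ with hU₀
  set U₁ : ℝ → ℝ≥0∞ := fun τ =>
    ENNReal.ofReal ((1 + τ ^ 2) ^ (-(a₁ / 2))) * ‖dampedEvolution R x (f i₁) τ‖ₑ with hU₁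
  have hU₀m : Measurable U₀ := by
    have := (measurable_dampedEvolution R x (f i₀)).enorm
    fun_prop
  have hU₁m : Measurable U₁ := by
    have := (measurable_dampedEvolution R x (f i₁)).enorm
    fun_prop
  have hprodT : ∀ τ : ℝ, ∏ i ∈ T, ‖dampedEvolution R x (f i) τ‖ₑ ≤
      C ^ T.card * ENNReal.ofReal ((1 + τ ^ 2) ^ ((m - 2 : ℝ) / 4)) * ∏ i ∈ T, G i := by
    intro τ
    calc _ ≤ ∏ i ∈ T, (C * ENNReal.ofReal ((1 + τ ^ 2) ^ (1 / 4 : ℝ)) * G i) := by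
          refine Finset.prod_le_prod' fun i hiT => ?_
          have h := hC (f i) R x τ hR
          simpa only [hG, hTs i hiT, div_one, ENNReal.rpow_one] using h
      _ = _ := by
          rw [Finset.prod_mul_distrib, Finset.prod_const, mul_pow,
            ← ENNReal.ofReal_pow (by positivity), ← Real.rpow_natCast,
            ← Real.rpow_mul (by positivity), hTcard]
          congr 4; ring
  have hpt : ∀ τ : ℝ, ‖(1 + (τ : ℂ) * Complex.I) ^ (((-(α + 1) : ℝ)) : ℂ) *
      Complex.exp (1 + τ * Complex.I) * ∏ i, dampedEvolution R x (f i) τ‖ₑ ≤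
      ENNReal.ofReal (Real.exp 1) * (C ^ T.card * ∏ i ∈ T, G i) * (U₀ τ * U₁ τ) := by
    intro τ
    have hw : ‖(1 + (τ : ℂ) * Complex.I) ^ (((-(α + 1) : ℝ)) : ℂ) *
        Complex.exp (1 + τ * Complex.I)‖ₑ =
        ENNReal.ofReal ((1 + τ ^ 2) ^ (-(α + 1) / 2)) * ENNReal.ofReal (Real.exp 1) := by
      rw [← ofReal_norm, norm_mul, norm_one_add_mul_I_cpow, Complex.norm_exp,
        ENNReal.ofReal_mul (by positivity)]
      simp
    -- The exponent balance: the Laplace weight and the growth `(m - 2)/4` from the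
    -- pointwise-estimated factors leave `-(a₀ + a₁)/2`, to be shared by the two mean-square
    -- factors.
    have hpw : ENNReal.ofReal ((1 + τ ^ 2) ^ (-(α + 1) / 2)) *
        ENNReal.ofReal ((1 + τ ^ 2) ^ ((m - 2 : ℝ) / 4)) =
        ENNReal.ofReal ((1 + τ ^ 2) ^ (-(a₀ / 2))) *
        ENNReal.ofReal ((1 + τ ^ 2) ^ (-(a₁ / 2))) := by
      rw [← ENNReal.ofReal_mul (by positivity), ← ENNReal.ofReal_mul (by positivity),
        ← Real.rpow_add (by positivity), ← Real.rpow_add (by positivity)]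
      congr 2; linarith
    have hpe : ‖∏ i, dampedEvolution R x (f i) τ‖ₑ = ∏ i, ‖dampedEvolution R x (f i) τ‖ₑ := by
      simp only [← ofReal_norm, norm_prod]
      rw [ENNReal.ofReal_prod_of_nonneg fun _ _ => norm_nonneg _]
    rw [enorm_mul, hw, hpe, hsplit]
    calc _ ≤ ENNReal.ofReal ((1 + τ ^ 2) ^ (-(α + 1) / 2)) * ENNReal.ofReal (Real.exp 1) *
          (‖dampedEvolution R x (f i₀) τ‖ₑ * (‖dampedEvolution R x (f i₁) τ‖ₑ *
          (C ^ T.card * ENNReal.ofReal ((1 + τ ^ 2) ^ ((m - 2 : ℝ) / 4)) * ∏ i ∈ T, G i))) := by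
          gcongr
          exact hprodT τ
      _ = (ENNReal.ofReal ((1 + τ ^ 2) ^ (-(α + 1) / 2)) *
          ENNReal.ofReal ((1 + τ ^ 2) ^ ((m - 2 : ℝ) / 4))) * (ENNReal.ofReal (Real.exp 1) *
          (C ^ T.card * ∏ i ∈ T, G i) * (‖dampedEvolution R x (f i₀) τ‖ₑ *
          ‖dampedEvolution R x (f i₁) τ‖ₑ)) := by ring
      _ = _ := by rw [hpw, hU₀, hU₁]; ring
  have hCS : ∫⁻ τ, U₀ τ * U₁ τ ≤ (C₀ * G i₀) * (C₁ * G i₁) :=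
    (ENNReal.lintegral_mul_le_Lp_mul_Lq volume Real.HolderConjugate.two_two hU₀m.aemeasurable
      hU₁m.aemeasurable).trans (mul_le_mul' (hC₀ (f i₀) R x hR) (hC₁ (f i₁) R x hR))
  rw [bochnerRieszMean_eq_integral hα, enorm_mul, ← hc]
  have hce : ‖((c : ℝ) : ℂ)‖ₑ = ENNReal.ofReal c := by
    rw [← ofReal_norm, Complex.norm_real, Real.norm_of_nonneg hc0]
  calc _ ≤ ENNReal.ofReal c * (ENNReal.ofReal (Real.exp 1) * (C ^ T.card * ∏ i ∈ T, G i) *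
        ((C₀ * G i₀) * (C₁ * G i₁))) := by
        rw [hce]
        refine mul_le_mul_right ((enorm_integral_le_lintegral_enorm _).trans
          ((lintegral_mono hpt).trans ?_)) _
        rw [lintegral_const_mul _ (by fun_prop)]
        exact mul_le_mul_right hCS _
    _ = _ := by
        rw [hsplit G, ENNReal.coe_mul, ENNReal.coe_mul, ENNReal.coe_mul, ENNReal.coe_pow,
          show ((c * Real.exp 1).toNNReal : ℝ≥0∞) = ENNReal.ofReal (c * Real.exp 1) from rfl,
          ENNReal.ofReal_mul hc0]
        ring

/-! ### From pointwise domination to norm bounds -/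

/-- The `L ^ q` bound for the power maximal function of a Schwartz function. -/
lemma exists_lintegral_dyadicMaximal_rpow_le {s q : ℝ} (hs : 0 < s) (hsq : s < q) :
    ∃ C : ℝ≥0, ∀ f : 𝓢(ℝ, ℂ),
      ∫⁻ x, (dyadicMaximal (fun y => ‖f y‖ₑ ^ s) x ^ (1 / s)) ^ q ≤ C * ∫⁻ x, ‖f x‖ₑ ^ q := by
  obtain ⟨C, hC⟩ := lintegral_dyadicMaximal_rpow_le (r := q / s) ((one_lt_div hs).2 hsq)
  refine ⟨C, fun f => ?_⟩
  obtain ⟨B, hB⟩ := f.decay 0 0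
  have h := hC (fun y => ‖f y‖ₑ ^ s) (f.continuous.measurable.enorm.pow_const s)
    (ENNReal.ofReal B ^ s) (ENNReal.rpow_ne_top_of_nonneg hs.le ENNReal.ofReal_ne_top) fun x => by
      refine ENNReal.rpow_le_rpow ?_ hs.le
      rw [← ofReal_norm]
      exact ENNReal.ofReal_le_ofReal (by simpa using hB.2 x)
  simp only [← ENNReal.rpow_mul] at h ⊢
  rw [show s * (q / s) = q by field_simp] at h
  rwa [show 1 / s * q = q / s by ring]

lemma eLpNorm_ofReal_eq {ε : Type*} [ENorm ε] {p : ℝ} (hp : 0 < p) (f : ℝ → ε) :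
    eLpNorm f (ENNReal.ofReal p) volume = (∫⁻ x, ‖f x‖ₑ ^ p) ^ (1 / p) := by
  rw [eLpNorm_eq_lintegral_rpow_enorm_toReal (by simpa using hp) ENNReal.ofReal_ne_top,
    ENNReal.toReal_ofReal hp.le]

lemma maximalBochnerRieszBounded_of_le {m : ℕ} {α p : ℝ} {q s : Fin m → ℝ} (hp : 0 < p)
    (hpq : ∑ i, 1 / q i = 1 / p) (hs : ∀ i, 0 < s i) (hsq : ∀ i, s i < q i) {C : ℝ≥0}
    (hC : ∀ (f : Fin m → 𝓢(ℝ, ℂ)) (x : ℝ), maximalBochnerRiesz α f x ≤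
      C * ∏ i, dyadicMaximal (fun y => ‖f i y‖ₑ ^ s i) x ^ (1 / s i)) :
    MaximalBochnerRieszBounded α q p := by
  have hq0 : ∀ i, 0 < q i := fun i => (hs i).trans (hsq i)
  choose D hD using fun i => exists_lintegral_dyadicMaximal_rpow_le (hs i) (hsq i)
  refine ⟨C * ∏ i, D i ^ (1 / q i), fun f => ?_⟩
  set G : Fin m → ℝ → ℝ≥0∞ := fun i x =>
    dyadicMaximal (fun y => ‖f i y‖ₑ ^ s i) x ^ (1 / s i) with hG
  have hGm : ∀ i, Measurable (G i) := fun i =>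
    (measurable_dyadicMaximal ((f i).continuous.measurable.enorm.pow_const (s i))).pow_const _
  -- Hölder for integrals with weights `p/qᵢ` summing to 1, applied to the `qᵢ`-th powers. Working
  -- with the integral of the p-th power avoids any triangle inequality, so `p < 1` is allowed.
  have hH := ENNReal.lintegral_prod_norm_pow_le (μ := (volume : Measure ℝ)) Finset.univ
    (f := fun i x => G i x ^ q i) (fun i _ => ((hGm i).pow_const _).aemeasurable)
    (p := fun i => p / q i)
    (by simp only [div_eq_mul_one_div p]; rw [← Finset.mul_sum, hpq, mul_one_div_cancel hp.ne'])
    (fun i _ => (div_pos hp (hq0 i)).le)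
  have e1 : ∀ x i, (G i x ^ q i) ^ (p / q i) = G i x ^ p := fun x i => by
    rw [← ENNReal.rpow_mul, mul_div_cancel₀ _ (hq0 i).ne']
  simp only [e1] at hH
  rw [eLpNorm_ofReal_eq hp]
  calc _ ≤ (∫⁻ x, C ^ p * ∏ i, G i x ^ p) ^ (1 / p) := by
        refine ENNReal.rpow_le_rpow (lintegral_mono fun x => ?_) (by positivity)
        rw [ENNReal.prod_rpow_of_nonneg hp.le, ← ENNReal.mul_rpow_of_nonneg _ _ hp.le,
          enorm_eq_self]
        exact ENNReal.rpow_le_rpow (hC f x) hp.le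
    _ ≤ (C ^ p * ∏ i, (∫⁻ x, G i x ^ q i) ^ (p / q i)) ^ (1 / p) := by
        rw [lintegral_const_mul _ (Finset.measurable_fun_prod _ fun i _ => (hGm i).pow_const _)]
        gcongr
    _ = C * ∏ i, (∫⁻ x, G i x ^ q i) ^ (1 / q i) := by
        rw [ENNReal.mul_rpow_of_nonneg _ _ (by positivity), ← ENNReal.rpow_mul,
          mul_one_div_cancel hp.ne', ENNReal.rpow_one,
          ← ENNReal.prod_rpow_of_nonneg (by positivity : 0 ≤ 1 / p)]
        congr 2; ext i
        rw [← ENNReal.rpow_mul]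
        congr 1; field_simp
    _ ≤ C * ∏ i, (D i * ∫⁻ x, ‖f i x‖ₑ ^ q i) ^ (1 / q i) := by
        refine mul_le_mul_right (Finset.prod_le_prod' fun i _ =>
          ENNReal.rpow_le_rpow (hD i (f i)) ?_) _
        exact (one_div_pos.2 (hq0 i)).le
    _ = _ := by
        rw [ENNReal.coe_mul, ENNReal.ofNNReal_finsetProd, mul_assoc, ← Finset.prod_mul_distrib]
        congr 2; ext i
        have hqi : 0 ≤ 1 / q i := (one_div_pos.2 (hq0 i)).le
        rw [ENNReal.mul_rpow_of_nonneg _ _ hqi, eLpNorm_ofReal_eq (hq0 i),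
          ENNReal.coe_rpow_of_nonneg _ hqi]

/-! ### Choice of exponents and the three cases -/

/-- An admissible exponent for the square function estimate. -/
lemma exists_exponent {q a : ℝ} (hq : 1 < q) (ha : max (1 / q) (1 / 2) < a) :
    ∃ s : ℝ, 1 < s ∧ s < 2 ∧ 1 < a * s ∧ s < q := by
  have hq0 : 0 < q := by linarith
  have h1 : max (1 / q) (1 / 2) < min 1 a := by
    refine lt_min (max_lt ?_ (by norm_num)) ha
    rw [div_lt_one hq0]; exact hq
  -- Here t plays the role of 1/s: the four strict bounds on t are the four required conditions on
  -- s.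
  obtain ⟨t, ht1, ht2⟩ := exists_between h1
  obtain ⟨h2, h3⟩ := max_lt_iff.1 ht1
  obtain ⟨h4, h5⟩ := lt_min_iff.1 ht2
  have ht0 : 0 < t := by linarith
  refine ⟨1 / t, (one_lt_div ht0).2 h4, ?_, ?_, (one_div_lt hq0 ht0).1 h2⟩
  · rw [div_lt_iff₀ ht0]; linarith
  · rw [mul_one_div, one_lt_div ht0]; exact h5

lemma maximalBochnerRieszBounded_of_sum_max_lt {m : ℕ} (hm : 2 ≤ m) {q : Fin m → ℝ}
    (hq : ∀ i, 1 < q i) {p α : ℝ} (hα : 0 < α) (hp : ∑ i, 1 / q i = 1 / p)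
    (h : ∑ i, max (1 / q i) (1 / 2) - 1 < α) : MaximalBochnerRieszBounded α q p := by
  set θ : Fin m → ℝ := fun i => max (1 / q i) (1 / 2) with hθ
  let i₀ : Fin m := ⟨0, by omega⟩
  let i₁ : Fin m := ⟨1, by omega⟩
  have hi : i₀ ≠ i₁ := by simp [i₀, i₁]
  -- Every θ is at least 1/2, so dropping all but two indices only lowers the sum; the choice of the
  -- two indices is arbitrary. This makes `θ i₀ + θ i₁` smaller than `α + 2 - m/2`, and ε below is
  -- half of the gap.
  have hsum : θ i₀ + θ i₁ - 1 ≤ ∑ i, (θ i - 1 / 2) := by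
    have h1 := Finset.sum_le_sum_of_subset_of_nonneg (f := fun i => θ i - 1 / 2)
      (Finset.subset_univ {i₀, i₁})
      (fun i _ _ => sub_nonneg.2 (le_max_right (1 / q i) (1 / 2)))
    rw [Finset.sum_pair hi] at h1
    linarith
  rw [Finset.sum_sub_distrib, Finset.sum_const, Finset.card_univ, Fintype.card_fin,
    nsmul_eq_mul] at hsum
  set ε := (α + 2 - m / 2 - θ i₀ - θ i₁) / 2 with hε
  have hε0 : 0 < ε := by rw [hε]; linarith
  obtain ⟨s₀, h01, h02, h03, h04⟩ := exists_exponent (hq i₀) (show θ i₀ < θ i₀ + ε by linarith)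
  obtain ⟨s₁, h11, h12, h13, h14⟩ := exists_exponent (hq i₁) (show θ i₁ < θ i₁ + ε by linarith)
  let s : Fin m → ℝ := fun i => if i = i₀ then s₀ else if i = i₁ then s₁ else 1
  have hs0 : s i₀ = s₀ := by simp [s]
  have hs1 : s i₁ = s₁ := by simp [s, hi.symm]
  have hse : ∀ i, i ≠ i₀ → i ≠ i₁ → s i = 1 := fun i h0 h1 => by simp [s, h0, h1]
  obtain ⟨C, hC⟩ := exists_maximalBochnerRiesz_le hα hi (s := s) (a₀ := θ i₀ + ε)
    (a₁ := θ i₁ + ε) (by rw [hs0]; exact ⟨h01, h02, h03⟩) (by rw [hs1]; exact ⟨h11, h12, h13⟩) hse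
    (by rw [hε]; ring)
  have hp0 : 0 < p := by
    rw [← one_div_pos, ← hp]
    exact Finset.sum_pos (fun i _ => one_div_pos.2 (by linarith [hq i])) ⟨i₀, Finset.mem_univ _⟩
  have hcases : ∀ i, 0 < s i ∧ s i < q i := by
    intro i
    by_cases h0 : i = i₀
    · rw [h0, hs0]; exact ⟨by linarith, h04⟩
    by_cases h1 : i = i₁
    · rw [h1, hs1]; exact ⟨by linarith, h14⟩
    rw [hse i h0 h1]; exact ⟨one_pos, hq i⟩
  exact maximalBochnerRieszBounded_of_le hp0 hp (fun i => (hcases i).1) (fun i => (hcases i).2) hC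

theorem mainTheorem5 (m : ℕ) (hm : 4 ≤ m) (q : Fin m → ℝ) (hq : ∀ i, 1 < q i)
    (p : ℝ) (hp : ∑ i, 1 / q i = 1 / p) (α : ℝ) :
    ((∀ i, 2 ≤ q i) → ((m : ℝ) - 2) / 2 < α → MaximalBochnerRieszBounded α q p) ∧
    (∀ (l : ℕ) (S : Finset (Fin m)), 1 ≤ l → l ≤ m - 1 → S.card = l →
      (∀ i ∈ S, q i < 2) → (∀ i ∉ S, 2 ≤ q i) →
      ∑ i ∈ S, 1 / q i + ((m : ℝ) - l - 2) / 2 < α → MaximalBochnerRieszBounded α q p) ∧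
    ((∀ i, q i < 2) → 1 / p - 1 < α → MaximalBochnerRieszBounded α q p) := by
  have hmR : (4 : ℝ) ≤ m := by exact_mod_cast hm
  have hlarge : ∀ i, 2 ≤ q i → max (1 / q i) (1 / 2) = 1 / 2 := fun i hi =>
    max_eq_right (one_div_le_one_div_of_le two_pos hi)
  have hsmall : ∀ i, q i < 2 → max (1 / q i) (1 / 2) = 1 / q i := fun i hi =>
    max_eq_left (one_div_le_one_div_of_le (by linarith [hq i]) hi.le)
  have hlow : (m : ℝ) / 2 ≤ ∑ i, max (1 / q i) (1 / 2) := by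
    have h := Finset.card_nsmul_le_sum Finset.univ (fun i => max (1 / q i) (1 / 2)) (1 / 2)
      (fun i _ => le_max_right _ _)
    rw [Finset.card_univ, Fintype.card_fin, nsmul_eq_mul] at h
    linarith
  -- Positivity of α comes for free: the sum is at least m/2, hence at least 2.
  have key : ∑ i, max (1 / q i) (1 / 2) - 1 < α → MaximalBochnerRieszBounded α q p := fun h =>
    maximalBochnerRieszBounded_of_sum_max_lt (by omega) hq (by linarith) hp h
  refine ⟨fun h hα => key ?_, fun l S _ _ hl hS hSc hα => key ?_, fun h hα => key ?_⟩
  · rw [Finset.sum_congr rfl fun i _ => hlarge i (h i), Finset.sum_const, Finset.card_univ,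
      Fintype.card_fin, nsmul_eq_mul]
    linarith
  · rw [← Finset.sum_add_sum_compl S, Finset.sum_congr rfl fun i hi => hsmall i (hS i hi),
      Finset.sum_congr rfl fun i hi => hlarge i (hSc i (Finset.mem_compl.1 hi)), Finset.sum_const,
      Finset.card_compl, Fintype.card_fin, nsmul_eq_mul,
      Nat.cast_sub (by simpa using S.card_le_univ), hl]
    linarith
  · rw [Finset.sum_congr rfl fun i _ => hsmall i (h i), hp]
    exact hα
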